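/- Consider an update-and-decision system with the following data: status updates are generated at the epochs of a Poisson process of rate $\lambda>0$; service times are i.i.d. copies of a nonnegative random variable $S$ with mean $\mathbb E[S]=1/\mu$, $0<\mu<\infty$, and otherwise general distribution; decisions are made at the epochs of a Poisson process of rate $\nu>0$; updates, service times and decisions are independent. Put $\rho=\lambda/\mu$. In the M/G/1-M system updates wait in an infinite buffer and are served one at a time, first come first served; in the bufferless M/G/1/1-M system an update is served if it is generated while the server is idle, and is dropped otherwise. Both systems start empty. A received (that is, fully served) update is missed if no decision is made from its departure until the departure of the next served update. The missing probability $p_{\rm mis}$ of a system is the almost sure limit, as $T\to\infty$, of the number of missed updates among those received up to time $T$ divided by the number of updates received up to time $T$ (dropped updates are not counted). Then for both systems the missing probability exists and is a constant determined by $\lambda$, $\nu$ and the law of $S$, and $$p_{\rm mis}^{\text{M/G/1/1-M}}\le p_{\rm mis}^{\text{M/G/1-M}}.$$ Moreover the two coincide in the limit $\rho\to0$: $p_{\rm mis}^{\text{M/G/1-M}}-p_{\rm mis}^{\text{M/G/1/1-M}}\to 0$ as $\rho\to0$, uniformly over all such $\lambda$, $\nu$ and laws of $S$ with given $\rho$.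 -/

import Mathlib

open MeasureTheory ProbabilityTheory Filter Topology

noncomputable section

namespace UpdateDecision

/-- Parameters of an update-and-decision system with Poisson generation of updates, general service
times and Poisson decisions: generation rate `lam`, service rate `mu`, decision rate `nu`, and the
law `service` of a service time, which is nonnegative with mean `1 / mu`. -/
structure Params where
  lam : ℝ
  mu : ℝ
  nu : ℝ
  service : Measure ℝ
  lam_pos : 0 < lam
  mu_pos : 0 < mu
  nu_pos : 0 < nu
  isProbabilityMeasure_service : IsProbabilityMeasure service
  service_nonneg : ∀ᵐ s ∂service, 0 ≤ s
  integrable_service : Integrable (fun s : ℝ => s) service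
  mean_service : ∫ s, s ∂service = 1 / mu

/-- The offered load `ρ = λ / μ`. -/
def Params.rho (p : Params) : ℝ := p.lam / p.mu

instance (p : Params) : IsProbabilityMeasure p.service := p.isProbabilityMeasure_service

instance (p : Params) : IsProbabilityMeasure (expMeasure p.lam) :=
  isProbabilityMeasure_expMeasure p.lam_pos

instance (p : Params) : IsProbabilityMeasure (expMeasure p.nu) :=
  isProbabilityMeasure_expMeasure p.nu_pos

/-- The law of the driving randomness `(X, S, Z)`: three independent i.i.d. sequences, namely the
exponential times `X` between generated updates, the service times `S`, and the exponential times
`Z` between decisions. -/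
def Params.law (p : Params) : Measure ((ℕ → ℝ) × (ℕ → ℝ) × (ℕ → ℝ)) :=
  (Measure.infinitePi fun _ : ℕ => expMeasure p.lam).prod
    ((Measure.infinitePi fun _ : ℕ => p.service).prod
      (Measure.infinitePi fun _ : ℕ => expMeasure p.nu))

/-- The epochs of a point process started at time `0` with successive gaps `g 0, g 1, …`. -/
def epoch (g : ℕ → ℝ) (n : ℕ) : ℝ := ∑ i ∈ Finset.range (n + 1), g i

/-- Infinite buffer, first come first served, initially empty: departure epoch of the `n`-th update
when the `n`-th update arrives at `A n` and needs service time `S n`. It enters service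
at the later of its own arrival and the previous departure. -/
def fcfsDeparture (A S : ℕ → ℝ) : ℕ → ℝ
  | 0 => A 0 + S 0
  | n + 1 => max (fcfsDeparture A S n) (A (n + 1)) + S (n + 1)

/-- No buffer, initially idle: index, among all generated updates, of the `k`-th successful update,
where the `k`-th successful update has service time `S k`. The next successful update is the
first one generated once the server is idle again; those generated in between are dropped. -/
def successful (A S : ℕ → ℝ) : ℕ → ℕ
  | 0 => 0
  | k + 1 => sInf {n | successful A S k < n ∧ A (successful A S k) + S k ≤ A n}

/-- No buffer: departure epoch of the `k`-th successful update. -/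
def blockingDeparture (A S : ℕ → ℝ) (k : ℕ) : ℝ := A (successful A S k) + S k

/-- With departure epochs `D` and decision epochs `τ`: the `k`-th received update is missed if no
decision is made from its departure until the next departure, that is, while it is the
most recently received update. -/
def Missed (D τ : ℕ → ℝ) (k : ℕ) : Prop := ∀ j, ¬(D k ≤ τ j ∧ τ j < D (k + 1))

/-- The number of missed updates among those received up to time `T`, divided by the number of
updates received up to time `T`. -/
def missingRatio (D τ : ℕ → ℝ) (T : ℝ) : ℝ :=
  ({k | D k ≤ T ∧ Missed D τ k}.ncard : ℝ) / ({k | D k ≤ T}.ncard : ℝ)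

/-- `q` is the missing probability of the system with parameters `p` whose departure epochs are
`dep A S` as a function of arrival epochs `A` and service times `S`: almost surely, the ratio of
missed updates to received updates over `[0, T]` tends to `q` as `T → ∞`. -/
def IsMissingProbability (dep : (ℕ → ℝ) → (ℕ → ℝ) → ℕ → ℝ) (p : Params) (q : ℝ) : Prop :=
  ∀ᵐ ω ∂p.law, Tendsto (missingRatio (dep (epoch ω.1) ω.2.1) (epoch ω.2.2)) atTop (𝓝 q)

end UpdateDecision

end

/-! Given the departures `D`, the decisions form an independent Poisson process of rate ν, so update
`k` is missed with conditional probability exp(-ν (D (k+1) - D k)). The missing probability is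
therefore the long-run average of these discounted inter-departure times
(`isMissingProbability_of_average`). In both systems an inter-departure time is an idle period
followed by an independent service time, so the discount factors and φ = E exp(-ν S) comes out.

Without a buffer, memorylessness makes the idle period exponential of rate λ, which gives φ λ/(λ+ν).
With a buffer, the idle period is (X - V)⁺, where V is the sojourn time of the departing update and
X the next interarrival time. Averaging over X gives the discount 1 - ν/(λ+ν) exp(-λ V), so only the
long-run average of exp(-λ V) is needed. No stationary law enters: the average idle period is
computed twice. Its conditional mean given V is exp(-λ V)/λ; pathwise, cumulative idle time is the
running maximum of a random walk, so its average is (1/λ - 1/μ)⁺. Hence exp(-λ V) averages to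
(1-ρ)⁺, also when ρ ≥ 1. The two missing probabilities differ by φ ν/(λ+ν) (1 - (1-ρ)⁺), which lies
in [0, ρ].

Every passage from a variable to its conditional mean is a law of large numbers for uncorrelated
compensated terms (`ae_tendsto_average_compensated`). Uncorrelatedness is proved without filtrations
or stopping times: one coordinate of the driving sequence is resampled, after a partition by its
index when that index is random (`Resamples.integral_eq_zero`, `integral_eq_zero_of_partition`). -/

namespace UpdateDecision

/-! ### Deterministic limits -/

/-- If the averages of `u` converge to `c`, those of its running maximum converge to `max c 0`. -/
lemma tendsto_runningMax_div {u J : ℕ → ℝ} {c : ℝ} (h0 : J 0 = 0)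
    (hJ : ∀ n, J (n + 1) = max (J n) (u (n + 1)))
    (hu : Tendsto (fun n : ℕ => u n / n) atTop (𝓝 c)) :
    Tendsto (fun n : ℕ => J n / n) atTop (𝓝 (max c 0)) := by
  have hJ0 : ∀ n, 0 ≤ J n := by
    intro n
    induction n with
    | zero => exact h0.ge
    | succ n ih => rw [hJ]; exact ih.trans (le_max_left _ _)
  have huJ : ∀ n, 1 ≤ n → u n ≤ J n := by
    intro n hn
    obtain ⟨m, rfl⟩ := Nat.exists_eq_add_of_le' hn
    rw [hJ]; exact le_max_right _ _
  refine tendsto_order.2 ⟨fun a ha => ?_, fun a ha => ?_⟩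
  · have h1 : Tendsto (fun n : ℕ => max (u n / n) 0) atTop (𝓝 (max c 0)) :=
      hu.max tendsto_const_nhds
    filter_upwards [h1.eventually_const_lt ha, eventually_ge_atTop 1] with n hn h1n
    refine hn.trans_le (max_le ?_ ?_)
    · gcongr
      exact huJ n h1n
    · exact div_nonneg (hJ0 n) n.cast_nonneg
  -- One ε covers the excess of `u n / n` over `c`, one covers `J M / n`, and the third keeps the
  -- final inequality strict.
  · set ε := (a - max c 0) / 3 with hε
    have hεpos : 0 < ε := by rw [hε]; linarith
    have h1 : ∀ᶠ n : ℕ in atTop, u n / n < c + ε := hu.eventually_lt_const (by linarith)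
    obtain ⟨N, hN⟩ := eventually_atTop.1 h1
    set M := max N 1
    have hM1 : 1 ≤ M := le_max_right _ _
    have hb : ∀ n, M ≤ n → J n ≤ J M + (max c 0 + ε) * n := by
      intro n hn
      induction n, hn using Nat.le_induction with
      | base =>
        have : 0 ≤ (max c 0 + ε) * M := by positivity
        linarith
      | succ n hn ih =>
        rw [hJ]
        refine max_le (ih.trans ?_) ?_
        · gcongr
          simp
        · have h2 := hN (n + 1) ((le_max_left N 1).trans (hn.trans n.le_succ))
          rw [div_lt_iff₀ (by positivity)] at h2
          have h3 : (c + ε) * ((n + 1 : ℕ) : ℝ) ≤ (max c 0 + ε) * ((n + 1 : ℕ) : ℝ) := by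
            gcongr
            exact le_max_left _ _
          linarith [hJ0 M]
    have h2 : Tendsto (fun n : ℕ => J M / n) atTop (𝓝 0) := tendsto_const_div_atTop_nhds_zero_nat _
    filter_upwards [h2.eventually_lt_const hεpos, eventually_ge_atTop M] with n hn hMn
    have hn0 : (0 : ℝ) < n := by exact_mod_cast hM1.trans hMn
    rw [div_lt_iff₀ hn0] at hn ⊢
    have h3 := hb n hMn
    have h4 : (max c 0 + ε + ε) * n < a * n := by
      gcongr
      rw [hε]; linarith
    linarith [add_mul (max c 0 + ε) ε (n : ℝ)]

/-- If the averages of `z` vanish along the squares and `z` is a difference `y - e` with `y`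
nonnegative and `e` valued in `[0, C]`, then the averages of `z` vanish. -/
lemma tendsto_average_of_tendsto_squares {y e : ℕ → ℝ} {C : ℝ} (hy : ∀ k, 0 ≤ y k)
    (he : ∀ k, 0 ≤ e k) (heC : ∀ k, e k ≤ C)
    (h : Tendsto (fun m : ℕ => (∑ k ∈ Finset.range (m ^ 2), (y k - e k)) / (m : ℝ) ^ 2)
      atTop (𝓝 0)) :
    Tendsto (fun n : ℕ => (∑ k ∈ Finset.range n, (y k - e k)) / n) atTop (𝓝 0) := by
  set T : ℕ → ℝ := fun n => ∑ k ∈ Finset.range n, (y k - e k) with hT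
  have hC : 0 ≤ C := (he 0).trans (heC 0)
  -- Partial sums may jump up freely but fall by at most `C` per step. Hence `T n` is bounded below
  -- from the previous square and above from the next one, and `y` needs no upper bound.
  have hstep : ∀ {a b : ℕ}, a ≤ b → T a - C * (b - a) ≤ T b := by
    intro a b hab
    induction b, hab using Nat.le_induction with
    | base => simp
    | succ b hab ih =>
      have : T (b + 1) = T b + (y b - e b) := Finset.sum_range_succ _ _
      rw [this]
      push_cast
      linarith [hy b, heC b]
  have hsq : Tendsto (fun n : ℕ => Nat.sqrt n) atTop atTop := by
    refine tendsto_atTop.2 fun b => ?_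
    filter_upwards [eventually_ge_atTop (b * b)] with n hn
    exact Nat.le_sqrt.2 hn
  set a : ℕ → ℝ := fun m => |T (m ^ 2) / (m : ℝ) ^ 2| with ha
  have ha0 : Tendsto a atTop (𝓝 0) := by
    have := h.abs
    rwa [abs_zero] at this
  -- For `m ≥ 1`, the 4 comes from `(m+1)² ≤ 4m²` and the 3 from the gap `(m+1)² - m² ≤ 3m` between
  -- squares.
  have hb : Tendsto (fun m : ℕ => a m + 4 * a (m + 1) + C * 3 / m) atTop (𝓝 0) := by
    have := (ha0.add ((ha0.comp (tendsto_add_atTop_nat 1)).const_mul 4)).add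
      (tendsto_const_div_atTop_nhds_zero_nat (C * 3))
    simpa using this
  refine squeeze_zero_norm' ?_ (hb.comp hsq)
  filter_upwards [eventually_ge_atTop 1] with n hn
  set m := Nat.sqrt n with hm
  have hm1 : 1 ≤ m := Nat.le_sqrt.2 (by simpa using hn)
  have h1 : m ^ 2 ≤ n := Nat.sqrt_le' n
  have h2 : n ≤ (m + 1) ^ 2 := (Nat.lt_succ_sqrt' n).le
  have hm0 : (0 : ℝ) < m := by exact_mod_cast hm1
  have h1' : (m : ℝ) ^ 2 ≤ n := by exact_mod_cast h1
  have h2' : (n : ℝ) ≤ ((m : ℝ) + 1) ^ 2 := by exact_mod_cast h2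
  have hn0 : (0 : ℝ) < n := by exact_mod_cast hn
  have hm1' : (1 : ℝ) ≤ m := by exact_mod_cast hm1
  have u1 := hstep h1
  have u2 := hstep h2
  push_cast at u1 u2
  have e1 : |T (m ^ 2)| = a m * (m : ℝ) ^ 2 := by
    rw [ha]; dsimp only
    rw [abs_div, abs_of_pos (by positivity : (0 : ℝ) < (m : ℝ) ^ 2)]
    field_simp
  have e2 : |T ((m + 1) ^ 2)| = a (m + 1) * ((m : ℝ) + 1) ^ 2 := by
    rw [ha]; dsimp only
    push_cast
    rw [abs_div, abs_of_pos (by positivity : (0 : ℝ) < ((m : ℝ) + 1) ^ 2)]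
    field_simp
  have a1 : 0 ≤ a m := abs_nonneg _
  have a2 : 0 ≤ a (m + 1) := abs_nonneg _
  have hC1 : C * (n - (m : ℝ) ^ 2) ≤ C * (3 * m) := by
    gcongr; nlinarith
  have hC2 : C * (((m : ℝ) + 1) ^ 2 - n) ≤ C * (3 * m) := by
    gcongr; nlinarith
  have e3 : a (m + 1) * ((m : ℝ) + 1) ^ 2 ≤ a (m + 1) * (4 * (m : ℝ) ^ 2) := by
    gcongr; nlinarith
  have key : |T n| ≤ (a m + 4 * a (m + 1) + C * 3 / m) * (m : ℝ) ^ 2 := by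
    have e4 : C * 3 / m * (m : ℝ) ^ 2 = C * (3 * m) := by field_simp
    rw [add_mul, e4, abs_le]
    have b1 := abs_le.1 e1.le
    have b2 := abs_le.1 e2.le
    have p1 : 0 ≤ a m * (m : ℝ) ^ 2 := by positivity
    have p2 : 0 ≤ a (m + 1) * (4 * (m : ℝ) ^ 2) := by positivity
    constructor <;> nlinarith
  have hpos : 0 ≤ a m + 4 * a (m + 1) + C * 3 / m := by positivity
  rw [Real.norm_eq_abs, abs_div, abs_of_pos hn0, div_le_iff₀ hn0]
  exact key.trans (mul_le_mul_of_nonneg_left h1' hpos)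

/-- The missing ratio over `[0, T]` has the limit of the average number of missed updates among
the first `n` received ones. -/
lemma tendsto_missingRatio {D τ : ℕ → ℝ} {q : ℝ} (hmono : Monotone D)
    (htop : Tendsto D atTop atTop)
    (h : Tendsto (fun n : ℕ => (∑ k ∈ Finset.range n, {k | Missed D τ k}.indicator 1 k) / (n : ℝ))
      atTop (𝓝 q)) :
    Tendsto (missingRatio D τ) atTop (𝓝 q) := by
  classical
  have hex : ∀ T, ∃ n, T < D n := fun T => (htop.eventually_gt_atTop T).exists
  -- By monotonicity the indices of departures up to `T` are exactly those below `N T`, so the ratio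
  -- at time `T` is the average over the first `N T` updates.
  set N : ℝ → ℕ := fun T => Nat.find (hex T) with hN
  have hmem : ∀ T k, D k ≤ T ↔ k < N T := by
    intro T k
    rw [hN, Nat.lt_find_iff]
    exact ⟨fun hk m hm => not_lt.2 ((hmono hm).trans hk), fun hk => not_lt.1 (hk k le_rfl)⟩
  have hNtop : Tendsto N atTop atTop := by
    refine tendsto_atTop.2 fun b => ?_
    filter_upwards [eventually_ge_atTop (D b)] with T hT
    exact ((hmem T b).1 hT).le
  refine (h.comp hNtop).congr fun T => ?_
  have h1 : {k | D k ≤ T} = (Finset.range (N T) : Set ℕ) := by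
    ext k; simp [hmem]
  have h2 : {k | D k ≤ T ∧ Missed D τ k}
      = ((Finset.range (N T)).filter (Missed D τ) : Finset ℕ) := by
    ext k; simp [hmem]
  rw [missingRatio, h1, h2, Set.ncard_coe_finset, Set.ncard_coe_finset, Finset.card_range,
    Finset.card_filter]
  simp [Set.indicator_apply]

/-! ### A law of large numbers for uncorrelated variables -/

/-- Orthogonality removes the cross terms, so second moments add. -/
lemma integral_sq_sum_le {Ω : Type*} [MeasurableSpace Ω] {P : Measure Ω}
    {Z : ℕ → Ω → ℝ} {C : ℝ} (hL : ∀ k, MemLp (Z k) 2 P)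
    (hC : ∀ k, ∫ ω, Z k ω ^ 2 ∂P ≤ C) (h0 : ∀ j k, j < k → ∫ ω, Z j ω * Z k ω ∂P = 0) (n : ℕ) :
    ∫ ω, (∑ k ∈ Finset.range n, Z k ω) ^ 2 ∂P ≤ C * n := by
  induction n with
  | zero => simp
  | succ n ih =>
    have hS : MemLp (fun ω => ∑ k ∈ Finset.range n, Z k ω) 2 P :=
      memLp_finsetSum _ fun k _ => hL k
    have i1 : Integrable (fun ω => (∑ k ∈ Finset.range n, Z k ω) ^ 2) P := hS.integrable_sq
    have i2 : Integrable (fun ω => Z n ω ^ 2) P := (hL n).integrable_sq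
    have i4 : ∀ k, Integrable (fun ω => Z k ω * Z n ω) P := fun k => (hL k).integrable_mul (hL n)
    have i3 : Integrable (fun ω => 2 * ∑ k ∈ Finset.range n, Z k ω * Z n ω) P :=
      (integrable_finsetSum _ fun k _ => i4 k).const_mul 2
    have e : ∀ ω, (∑ k ∈ Finset.range (n + 1), Z k ω) ^ 2
        = (∑ k ∈ Finset.range n, Z k ω) ^ 2 + 2 * (∑ k ∈ Finset.range n, Z k ω * Z n ω)
          + Z n ω ^ 2 := by
      intro ω
      rw [Finset.sum_range_succ, ← Finset.sum_mul]; ring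
    simp_rw [e]
    have i5 : Integrable (fun ω => (∑ k ∈ Finset.range n, Z k ω) ^ 2
        + 2 * ∑ k ∈ Finset.range n, Z k ω * Z n ω) P := i1.add i3
    rw [integral_add i5 i2, integral_add i1 i3, integral_const_mul,
      integral_finsetSum _ fun k _ => i4 k,
      Finset.sum_eq_zero fun k hk => h0 k n (Finset.mem_range.1 hk)]
    push_cast
    linarith [hC n]

/-- Along squares the average has second moment at most `C / m²`, which is summable. The squared
averages then have an almost surely finite sum, so they tend to 0. -/
lemma ae_tendsto_average_squares {Ω : Type*} [MeasurableSpace Ω] {P : Measure Ω}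
    {Z : ℕ → Ω → ℝ} {C : ℝ} (hL : ∀ k, MemLp (Z k) 2 P)
    (hC : ∀ k, ∫ ω, Z k ω ^ 2 ∂P ≤ C) (h0 : ∀ j k, j < k → ∫ ω, Z j ω * Z k ω ∂P = 0) :
    ∀ᵐ ω ∂P, Tendsto (fun m : ℕ => (∑ k ∈ Finset.range (m ^ 2), Z k ω) / (m : ℝ) ^ 2)
      atTop (𝓝 0) := by
  set g : ℕ → Ω → ℝ := fun m ω => ((∑ k ∈ Finset.range (m ^ 2), Z k ω) / (m : ℝ) ^ 2) ^ 2 with hg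
  have hS : ∀ n, MemLp (fun ω => ∑ k ∈ Finset.range n, Z k ω) 2 P :=
    fun n => memLp_finsetSum _ fun k _ => hL k
  have hgi : ∀ m, Integrable (g m) P := fun m => by
    have := ((hS (m ^ 2)).integrable_sq).div_const (((m : ℝ) ^ 2) ^ 2)
    simpa only [hg, div_pow] using this
  have hC0 : 0 ≤ C := (integral_nonneg fun ω => sq_nonneg _).trans (hC 0)
  have hgb : ∀ m, ∫ ω, g m ω ∂P ≤ C * (1 / (m : ℝ) ^ 2) := by
    intro m
    simp only [hg, div_pow]
    rw [integral_div]
    rcases Nat.eq_zero_or_pos m with rfl | hm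
    · simp
    have := integral_sq_sum_le hL hC h0 (m ^ 2)
    have hm' : (0 : ℝ) < m := by exact_mod_cast hm
    rw [div_le_iff₀ (by positivity)]
    refine this.trans_eq ?_
    push_cast
    field_simp
  have hsum : Summable fun m : ℕ => C * (1 / (m : ℝ) ^ 2) :=
    (Real.summable_one_div_nat_pow.2 one_lt_two).mul_left C
  have hfin : ∫⁻ ω, ∑' m, ENNReal.ofReal (g m ω) ∂P ≠ ⊤ := by
    rw [lintegral_tsum fun m => (hgi m).aestronglyMeasurable.aemeasurable.ennreal_ofReal]
    refine ne_top_of_le_ne_top hsum.tsum_ofReal_ne_top ?_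
    refine ENNReal.tsum_le_tsum fun m => ?_
    rw [← ofReal_integral_eq_lintegral_ofReal (hgi m) (ae_of_all _ fun ω => sq_nonneg _)]
    exact ENNReal.ofReal_le_ofReal (hgb m)
  have hae := ae_lt_top' (AEMeasurable.tsum fun m =>
    (hgi m).aestronglyMeasurable.aemeasurable.ennreal_ofReal) hfin
  filter_upwards [hae] with ω hω
  have h1 := ENNReal.tendsto_atTop_zero_of_tsum_ne_top hω.ne
  have h2 : Tendsto (fun m => g m ω) atTop (𝓝 0) := by
    have := (ENNReal.tendsto_toReal ENNReal.zero_ne_top).comp h1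
    refine this.congr fun m => ?_
    simp [hg, ENNReal.toReal_ofReal (sq_nonneg _)]
  have h3 := (Real.continuous_sqrt.tendsto 0).comp h2
  rw [Real.sqrt_zero] at h3
  refine tendsto_zero_iff_abs_tendsto_zero _ |>.2 (h3.congr fun m => ?_)
  simp [hg, Real.sqrt_sq_eq_abs]

/-- Law of large numbers for nonnegative variables `Y k` that are compensated by bounded variables
`e k` so that the differences are uncorrelated and bounded in `L²`. -/
lemma ae_tendsto_average_compensated {Ω : Type*} [MeasurableSpace Ω] {P : Measure Ω}
    {Y e : ℕ → Ω → ℝ} {B C : ℝ} (hY : ∀ k, ∀ᵐ ω ∂P, 0 ≤ Y k ω)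
    (he : ∀ k, ∀ᵐ ω ∂P, 0 ≤ e k ω ∧ e k ω ≤ B)
    (hL : ∀ k, MemLp (fun ω => Y k ω - e k ω) 2 P)
    (hC : ∀ k, ∫ ω, (Y k ω - e k ω) ^ 2 ∂P ≤ C)
    (h0 : ∀ j k, j < k → ∫ ω, (Y j ω - e j ω) * (Y k ω - e k ω) ∂P = 0) :
    ∀ᵐ ω ∂P, Tendsto (fun n : ℕ => (∑ k ∈ Finset.range n, (Y k ω - e k ω)) / n) atTop (𝓝 0) := by
  filter_upwards [ae_tendsto_average_squares hL hC h0, ae_all_iff.2 hY, ae_all_iff.2 he]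
    with ω h1 h2 h3
  exact tendsto_average_of_tendsto_squares h2 (fun k => (h3 k).1) (fun k => (h3 k).2) h1

lemma norm_sub_le_one {a b : ℝ} (ha : 0 ≤ a ∧ a ≤ 1) (hb : 0 ≤ b ∧ b ≤ 1) : ‖a - b‖ ≤ 1 := by
  rw [Real.norm_eq_abs, abs_le]
  constructor <;> linarith

/-- Bounded case of `ae_tendsto_average_compensated`. -/
lemma ae_tendsto_average_compensated_of_le_one {Ω : Type*} [MeasurableSpace Ω] {P : Measure Ω}
    [IsProbabilityMeasure P] {Y e : ℕ → Ω → ℝ} (hYm : ∀ k, Measurable (Y k))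
    (hem : ∀ k, Measurable (e k)) (hY : ∀ k, ∀ᵐ ω ∂P, 0 ≤ Y k ω ∧ Y k ω ≤ 1)
    (he : ∀ k, ∀ᵐ ω ∂P, 0 ≤ e k ω ∧ e k ω ≤ 1)
    (h0 : ∀ j k, j < k → ∫ ω, (Y j ω - e j ω) * (Y k ω - e k ω) ∂P = 0) :
    ∀ᵐ ω ∂P, Tendsto (fun n : ℕ => (∑ k ∈ Finset.range n, (Y k ω - e k ω)) / n) atTop (𝓝 0) := by
  have hb : ∀ k, ∀ᵐ ω ∂P, ‖Y k ω - e k ω‖ ≤ 1 := fun k => by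
    filter_upwards [hY k, he k] with ω h1 h2
    exact norm_sub_le_one h1 h2
  have hL : ∀ k, MemLp (fun ω => Y k ω - e k ω) 2 P := fun k =>
    MemLp.of_bound ((hYm k).sub (hem k)).aestronglyMeasurable 1 (hb k)
  refine ae_tendsto_average_compensated (C := 1) (fun k => (hY k).mono fun _ h => h.1) he hL
    (fun k => ?_) h0
  have h1 : ∫ ω, (Y k ω - e k ω) ^ 2 ∂P ≤ ∫ _, (1 : ℝ) ∂P := by
    refine integral_mono_ae (hL k).integrable_sq (integrable_const 1) ?_
    filter_upwards [hb k] with ω h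
    rw [Real.norm_eq_abs] at h
    rw [← sq_abs]
    exact pow_le_one₀ (abs_nonneg _) h
  simpa using h1

/-! ### The exponential distribution -/

lemma integral_expMeasure {r : ℝ} (hr : 0 < r) (f : ℝ → ℝ) :
    ∫ x, f x ∂expMeasure r
      = ∫ x, (Set.Ioi 0).indicator (fun x => f x * (r * Real.exp (-(r * x)))) x := by
  have hm : Measurable (exponentialPDF r) := (measurable_exponentialPDFReal r).ennreal_ofReal
  have h : expMeasure r = volume.withDensity (exponentialPDF r) := rfl
  rw [h, integral_withDensity_eq_integral_toReal_smul hm (by simp [exponentialPDF])]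
  refine integral_congr_ae ?_
  -- The density is `r` at 0 while the indicator of `Ioi 0` vanishes there; the discrepancy is a
  -- null set.
  have h0 : ∀ᵐ x : ℝ, x ≠ 0 := by simp [ae_iff]
  filter_upwards [h0] with x hx
  rw [exponentialPDF_eq]
  rcases lt_or_gt_of_ne hx with h | h
  · simp [not_le.2 h, not_lt.2 h.le]
  · rw [if_pos h.le, Set.indicator_of_mem (Set.mem_Ioi.2 h), ENNReal.toReal_ofReal (by positivity),
      smul_eq_mul, mul_comm]

lemma ae_nonneg_expMeasure (r : ℝ) : ∀ᵐ x ∂expMeasure r, 0 ≤ x := by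
  have h : expMeasure r = volume.withDensity (exponentialPDF r) := rfl
  have hm : Measurable (exponentialPDF r) := (measurable_exponentialPDFReal r).ennreal_ofReal
  rw [h, ae_withDensity_iff hm]
  refine ae_of_all _ fun x hx => ?_
  by_contra hx0
  exact hx (exponentialPDF_of_neg (not_le.1 hx0))

/-- The memoryless property of the exponential distribution. -/
lemma integral_expMeasure_residual {r : ℝ} (hr : 0 < r) (f : ℝ → ℝ) {t : ℝ} (ht : 0 ≤ t) :
    ∫ y, (if t ≤ y then f (y - t) else 0) ∂expMeasure r
      = Real.exp (-(r * t)) * ∫ y, f y ∂expMeasure r := by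
  rw [integral_expMeasure hr, integral_expMeasure hr, ← integral_const_mul]
  refine Eq.trans (integral_congr_ae ?_) (integral_sub_right_eq_self _ t)
  have h0 : ∀ᵐ x : ℝ, x ≠ t := by simp [ae_iff]
  filter_upwards [h0] with x hx
  rcases lt_or_gt_of_ne hx with h | h
  · simp [Set.indicator_apply, not_le.2 h, not_lt.2 h.le]
  · rw [Set.indicator_of_mem (Set.mem_Ioi.2 (ht.trans_lt h)),
      Set.indicator_of_mem (Set.mem_Ioi.2 (sub_pos.2 h)), if_pos h.le]
    have : Real.exp (-(r * x)) = Real.exp (-(r * t)) * Real.exp (-(r * (x - t))) := by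
      rw [← Real.exp_add]; ring_nf
    rw [this]; ring

lemma integral_pow_expMeasure {r : ℝ} (hr : 0 < r) (k : ℕ) :
    ∫ x, x ^ k ∂expMeasure r = k.factorial / r ^ k := by
  rw [integral_expMeasure hr, integral_indicator measurableSet_Ioi]
  have h := Real.integral_rpow_mul_exp_neg_mul_Ioi (a := (k : ℝ) + 1) (by positivity) hr
  rw [Real.Gamma_nat_eq_factorial] at h
  have e : ∀ x : ℝ, x ^ k * (r * Real.exp (-(r * x)))
      = r * (x ^ ((k : ℝ) + 1 - 1) * Real.exp (-(r * x))) := by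
    intro x
    rw [add_sub_cancel_right, Real.rpow_natCast]; ring
  simp_rw [e]
  rw [integral_const_mul, h]
  have : (1 / r) ^ ((k : ℝ) + 1) = (1 / r) ^ (k + 1) := by
    rw [← Real.rpow_natCast]; push_cast; rfl
  rw [this, one_div_pow, pow_succ]
  field_simp

lemma integrable_pow_expMeasure {r : ℝ} (hr : 0 < r) (k : ℕ) :
    Integrable (fun x : ℝ => x ^ k) (expMeasure r) := by
  -- The Bochner integral of a non-integrable function is 0 by convention, so a positive value
  -- forces integrability.
  by_contra h
  have := integral_undef h
  rw [integral_pow_expMeasure hr] at this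
  have : (0 : ℝ) < k.factorial / r ^ k := by positivity
  linarith

lemma integral_exp_neg_expMeasure {r s : ℝ} (hr : 0 < r) (hs : 0 < s) :
    ∫ x, Real.exp (-(s * x)) ∂expMeasure r = r / (r + s) := by
  rw [integral_expMeasure hr, integral_indicator measurableSet_Ioi]
  have h := integral_exp_mul_Ioi (a := -(r + s)) (by linarith) 0
  have e : ∀ x : ℝ, Real.exp (-(s * x)) * (r * Real.exp (-(r * x)))
      = r * Real.exp (-(r + s) * x) := by
    intro x
    rw [mul_left_comm, ← Real.exp_add]; ring_nf
  simp_rw [e]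
  rw [integral_const_mul, h]
  rw [mul_zero, Real.exp_zero, neg_div_neg_eq, mul_one_div]

lemma integrable_exp_neg_expMeasure {r s : ℝ} (hr : 0 < r) (hs : 0 < s) :
    Integrable (fun x => Real.exp (-(s * x))) (expMeasure r) := by
  by_contra h
  have := integral_undef h
  rw [integral_exp_neg_expMeasure hr hs] at this
  have : (0 : ℝ) < r / (r + s) := by positivity
  linarith

/-- The tail of the exponential distribution. -/
lemma integral_expMeasure_tail {r : ℝ} (hr : 0 < r) {t : ℝ} (ht : 0 ≤ t) :
    ∫ y, (if t ≤ y then (1 : ℝ) else 0) ∂expMeasure r = Real.exp (-(r * t)) := by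
  have := isProbabilityMeasure_expMeasure hr
  simpa using integral_expMeasure_residual hr (fun _ => 1) ht

lemma integral_max_sub_expMeasure {r : ℝ} (hr : 0 < r) {v : ℝ} (hv : 0 ≤ v) :
    ∫ y, max (y - v) 0 ∂expMeasure r = Real.exp (-(r * v)) / r := by
  have h := integral_expMeasure_residual hr (fun x => x ^ 1) hv
  rw [integral_pow_expMeasure hr] at h
  simp only [pow_one, Nat.factorial_one, Nat.cast_one, mul_one_div] at h
  rw [← h]
  congr 1 with y
  split_ifs with hy
  · exact max_eq_left (sub_nonneg.2 hy)
  · exact max_eq_right (sub_nonpos.2 (not_le.1 hy).le)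

/-- The function `exp (-(s * (y - v)⁺)) - 1` vanishes for `y < v`, so the memoryless property
applies to it: its mean is `exp (-(r * v))` times `r / (r + s) - 1`. -/
lemma integral_exp_neg_max_sub_expMeasure {r s : ℝ} (hr : 0 < r) (hs : 0 < s) {v : ℝ}
    (hv : 0 ≤ v) :
    ∫ y, (Real.exp (-(s * max (y - v) 0)) - (1 - s / (r + s) * Real.exp (-(r * v))))
      ∂expMeasure r = 0 := by
  have := isProbabilityMeasure_expMeasure hr
  have h := integral_expMeasure_residual hr (fun x => Real.exp (-(s * x)) - 1) hv
  rw [integral_sub (integrable_exp_neg_expMeasure hr hs) (integrable_const _),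
    integral_exp_neg_expMeasure hr hs] at h
  have e : ∀ y, Real.exp (-(s * max (y - v) 0))
      = (if v ≤ y then Real.exp (-(s * (y - v))) - 1 else 0) + 1 := by
    intro y
    split_ifs with hy
    · rw [max_eq_left (sub_nonneg.2 hy)]; ring
    · rw [max_eq_right (sub_nonpos.2 (not_le.1 hy).le)]; simp
  have hm : Measurable fun y => Real.exp (-(s * max (y - v) 0)) := by fun_prop
  have hi : Integrable (fun y => Real.exp (-(s * max (y - v) 0))) (expMeasure r) := by
    refine Integrable.of_bound hm.aestronglyMeasurable 1 (ae_of_all _ fun y => ?_)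
    rw [Real.norm_eq_abs, abs_of_pos (Real.exp_pos _), Real.exp_le_one_iff]
    have : 0 ≤ s * max (y - v) 0 := by positivity
    linarith
  rw [integral_sub hi (integrable_const _)]
  simp_rw [e] at hi ⊢
  have hi' : Integrable (fun y => if v ≤ y then Real.exp (-(s * (y - v))) - 1 else 0)
      (expMeasure r) := by
    refine (hi.sub (integrable_const (1 : ℝ))).congr (ae_of_all _ fun y => ?_)
    simp
  rw [integral_add hi' (integrable_const _), h]
  simp
  field_simp
  ring

/-! ### Resampling one coordinate -/

/-- `R ω y` replaces by `y` a coordinate of `ω` which has law `m` and is independent of the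
others. -/
def Resamples {Ω : Type*} [MeasurableSpace Ω] (P : Measure Ω) (m : Measure ℝ) (R : Ω → ℝ → Ω) :
    Prop :=
  MeasurePreserving (fun q : Ω × ℝ => R q.1 q.2) (P.prod m) P

/-- Checked on finite boxes, which determine the product measure: if `n` is among the constrained
coordinates, its factor is taken from `y` instead of `x`; otherwise the update is invisible. -/
lemma resamples_infinitePi (m : Measure ℝ) [IsProbabilityMeasure m] (n : ℕ) :
    Resamples (Measure.infinitePi fun _ : ℕ => m) m fun x y => Function.update x n y := by
  have hm : Measurable fun q : (ℕ → ℝ) × ℝ => Function.update q.1 n q.2 := by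
    rw [measurable_pi_iff]
    intro i
    by_cases hi : i = n
    · subst hi; simpa using measurable_snd
    · simp only [Function.update_of_ne hi]
      fun_prop
  refine ⟨hm, Measure.eq_infinitePi _ fun s t ht => ?_⟩
  rw [Measure.map_apply hm (MeasurableSet.pi s.countable_toSet fun i _ => ht i)]
  by_cases hn : n ∈ s
  · have : (fun q : (ℕ → ℝ) × ℝ => Function.update q.1 n q.2) ⁻¹' Set.pi s t
        = (Set.pi (s.erase n : Finset ℕ) t) ×ˢ t n := by
      ext ⟨x, y⟩
      simp only [Set.mem_preimage, Set.mem_pi, Finset.mem_coe, Set.mem_prod, Finset.mem_erase]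
      refine ⟨fun h => ⟨fun i hi => ?_, by simpa using h n hn⟩, fun h i hi => ?_⟩
      · simpa [Function.update_of_ne hi.1] using h i hi.2
      · by_cases hin : i = n
        · subst hin; simpa using h.2
        · simpa [Function.update_of_ne hin] using h.1 i ⟨hin, hi⟩
    rw [this, Measure.prod_prod, Measure.infinitePi_pi _ fun i _ => ht i,
      Finset.prod_erase_mul _ _ hn]
  · have : (fun q : (ℕ → ℝ) × ℝ => Function.update q.1 n q.2) ⁻¹' Set.pi s t
        = (Set.pi s t) ×ˢ Set.univ := by
      ext ⟨x, y⟩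
      simp only [Set.mem_preimage, Set.mem_pi, Finset.mem_coe, Set.mem_prod, Set.mem_univ,
        and_true]
      refine forall₂_congr fun i hi => ?_
      rw [Function.update_of_ne (ne_of_mem_of_not_mem hi hn)]
    rw [this, Measure.prod_prod, Measure.infinitePi_pi _ fun i _ => ht i, measure_univ, mul_one]

lemma Resamples.snd {Ω Ω' : Type*} [MeasurableSpace Ω] [MeasurableSpace Ω'] {P : Measure Ω}
    (Q : Measure Ω') {m : Measure ℝ} [SFinite P] [SFinite Q] [SFinite m] {R : Ω → ℝ → Ω}
    (h : Resamples P m R) :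
    Resamples (Q.prod P) m fun ω y => (ω.1, R ω.2 y) :=
  ((MeasurePreserving.id Q).prod h).comp (measurePreserving_prodAssoc Q P m)

lemma Resamples.fst {Ω Ω' : Type*} [MeasurableSpace Ω] [MeasurableSpace Ω'] {P : Measure Ω}
    (Q : Measure Ω') {m : Measure ℝ} [SFinite P] [SFinite Q] [SFinite m] {R : Ω → ℝ → Ω}
    (h : Resamples P m R) :
    Resamples (P.prod Q) m fun ω y => (R ω.1 y, ω.2) :=
  Measure.measurePreserving_swap.comp
    ((h.snd Q).comp (Measure.measurePreserving_swap.prod (MeasurePreserving.id m)))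

/-- A function whose average over the resampled coordinate vanishes has zero integral. -/
lemma Resamples.integral_eq_zero {Ω : Type*} [MeasurableSpace Ω] {P : Measure Ω} {m : Measure ℝ}
    [SFinite P] [SFinite m] {R : Ω → ℝ → Ω} (h : Resamples P m R) {F : Ω → ℝ}
    (hF : Integrable F P) (h0 : ∀ᵐ ω ∂P, ∫ y, F (R ω y) ∂m = 0) : ∫ ω, F ω ∂P = 0 := by
  have h1 : Integrable (fun q : Ω × ℝ => F (R q.1 q.2)) (P.prod m) :=
    (h.integrable_comp hF.aestronglyMeasurable).2 hF
  have h2 : ∫ q, F (R q.1 q.2) ∂(P.prod m) = ∫ ω, F ω ∂P := by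
    rw [← integral_map (f := F) h.aemeasurable (by rw [h.map_eq]; exact hF.aestronglyMeasurable),
      h.map_eq]
  rw [← h2, integral_prod _ h1]
  exact integral_eq_zero_of_ae h0

/-- Integrals vanish if they vanish over each piece of a countable partition. -/
lemma integral_eq_zero_of_partition {Ω : Type*} [MeasurableSpace Ω] {P : Measure Ω} {F : Ω → ℝ}
    {B : ℕ → Set Ω} (hF : Integrable F P) (hB : ∀ n, MeasurableSet (B n))
    (hd : Pairwise (Function.onFun Disjoint B)) (hc : ∀ᵐ ω ∂P, ∃ n, ω ∈ B n)
    (h : ∀ n, ∫ ω, (B n).indicator F ω ∂P = 0) : ∫ ω, F ω ∂P = 0 := by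
  have h1 : ∫ ω, F ω ∂P = ∫ ω in ⋃ n, B n, F ω ∂P := by
    rw [← integral_indicator (MeasurableSet.iUnion hB)]
    refine integral_congr_ae ?_
    filter_upwards [hc] with ω hω
    rw [Set.indicator_of_mem (Set.mem_iUnion.2 hω)]
  rw [h1, integral_iUnion hB hd hF.integrableOn]
  simp_rw [integral_indicator (hB _)] at h
  simp [h]

/-! ### Epochs -/

lemma epoch_eq (g : ℕ → ℝ) (n : ℕ) : epoch g n = ∑ i ∈ Finset.range n, g i + g n :=
  Finset.sum_range_succ _ _

lemma epoch_succ (g : ℕ → ℝ) (n : ℕ) : epoch g (n + 1) = epoch g n + g (n + 1) :=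
  Finset.sum_range_succ _ _

lemma epoch_update_of_lt (g : ℕ → ℝ) (y : ℝ) {i n : ℕ} (h : i < n) :
    epoch (Function.update g n y) i = epoch g i := by
  refine Finset.sum_congr rfl fun j hj => Function.update_of_ne ?_ _ _
  have := Finset.mem_range.1 hj
  omega

lemma epoch_update_self (g : ℕ → ℝ) (y : ℝ) (n : ℕ) :
    epoch (Function.update g n y) n = ∑ i ∈ Finset.range n, g i + y := by
  rw [epoch_eq, Function.update_self]
  congr 1
  exact Finset.sum_congr rfl fun j hj => Function.update_of_ne (Finset.mem_range.1 hj).ne _ _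

lemma epoch_mono {g : ℕ → ℝ} (h : ∀ i, 0 ≤ g i) : Monotone (epoch g) :=
  monotone_nat_of_le_succ fun n => by rw [epoch_succ]; linarith [h (n + 1)]

lemma measurable_epoch (n : ℕ) : Measurable fun g : ℕ → ℝ => epoch g n := by
  unfold epoch
  fun_prop

/-! ### Missed updates -/

/-- The indicator that the `k`-th received update is missed. -/
noncomputable def missedIndicator (D τ : ℕ → ℝ) (k : ℕ) : ℝ := {k | Missed D τ k}.indicator 1 k

lemma missedIndicator_eq (D τ : ℕ → ℝ) (k : ℕ) [Decidable (Missed D τ k)] :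
    missedIndicator D τ k = if Missed D τ k then 1 else 0 := by
  simp [missedIndicator, Set.indicator_apply]

lemma missedIndicator_nonneg (D τ : ℕ → ℝ) (k : ℕ) : 0 ≤ missedIndicator D τ k := by
  classical
  rw [missedIndicator_eq]
  split_ifs <;> simp

lemma missedIndicator_le_one (D τ : ℕ → ℝ) (k : ℕ) : missedIndicator D τ k ≤ 1 := by
  classical
  rw [missedIndicator_eq]
  split_ifs <;> simp

lemma measurable_missedIndicator {Ω : Type*} [MeasurableSpace Ω] {D τ : Ω → ℕ → ℝ}
    (hD : ∀ k, Measurable fun ω => D ω k) (hτ : ∀ k, Measurable fun ω => τ ω k) (k : ℕ) :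
    Measurable fun ω => missedIndicator (D ω) (τ ω) k := by
  classical
  simp_rw [missedIndicator_eq]
  refine Measurable.ite ?_ measurable_const measurable_const
  refine measurableSet_setOfPred.2 (Measurable.forall fun j => Measurable.not ?_)
  exact (measurableSet_setOfPred.1 (measurableSet_le (hD k) (hτ j))).and
    (measurableSet_setOfPred.1 (measurableSet_lt (hτ j) (hD (k + 1))))

section Decisions

variable {Ω : Type*} [MeasurableSpace Ω] {P : Measure Ω} [IsProbabilityMeasure P]
  {Z D : Ω → ℕ → ℝ} {R : ℕ → Ω → ℝ → Ω} {r : ℝ}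

/-- Partition by the index `n` of the first decision at or after `D k`. There the status of update
`j` is settled by decisions before `n`, and update `k` is missed exactly when decision `n` falls at
or after `D (k + 1)`. Resampling the gap `n` leaves an exponential overshoot past `D k`, so the
second factor averages to 0. -/
lemma integral_missed_compensated_mul (hr : 0 < r)
    (hR : ∀ n, Resamples P (expMeasure r) (R n))
    (hZR : ∀ n ω y, Z (R n ω y) = Function.update (Z ω) n y)
    (hDR : ∀ n ω y, D (R n ω y) = D ω)
    (hZm : ∀ n, Measurable fun ω => Z ω n) (hDm : ∀ n, Measurable fun ω => D ω n)
    (hZ : ∀ᵐ ω ∂P, ∀ n, 0 ≤ Z ω n) (hτ : ∀ᵐ ω ∂P, Tendsto (epoch (Z ω)) atTop atTop)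
    (hD : ∀ᵐ ω ∂P, Monotone (D ω)) (hD0 : ∀ᵐ ω ∂P, 0 ≤ D ω 0) {j k : ℕ} (hjk : j < k) :
    ∫ ω, (missedIndicator (D ω) (epoch (Z ω)) j - Real.exp (-(r * (D ω (j + 1) - D ω j))))
      * (missedIndicator (D ω) (epoch (Z ω)) k - Real.exp (-(r * (D ω (k + 1) - D ω k)))) ∂P
      = 0 := by
  classical
  have := isProbabilityMeasure_expMeasure hr
  have hτm : ∀ n, Measurable fun ω => epoch (Z ω) n :=
    fun n => (measurable_epoch n).comp (measurable_pi_iff.2 hZm)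
  have hMm := measurable_missedIndicator hDm hτm
  have hem : ∀ k, Measurable fun ω => Real.exp (-(r * (D ω (k + 1) - D ω k))) := fun k => by
    have h1 := hDm k
    have h2 := hDm (k + 1)
    fun_prop
  have hb : ∀ k, ∀ᵐ ω ∂P, ‖missedIndicator (D ω) (epoch (Z ω)) k
      - Real.exp (-(r * (D ω (k + 1) - D ω k)))‖ ≤ 1 := fun k => by
    filter_upwards [hD] with ω h
    have h1 : 0 ≤ r * (D ω (k + 1) - D ω k) := mul_nonneg hr.le (sub_nonneg.2 (h k.le_succ))
    have h2 : Real.exp (-(r * (D ω (k + 1) - D ω k))) ≤ 1 := by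
      rw [Real.exp_le_one_iff]; linarith
    rw [Real.norm_eq_abs, abs_le]
    constructor <;> linarith [missedIndicator_nonneg (D ω) (epoch (Z ω)) k,
      missedIndicator_le_one (D ω) (epoch (Z ω)) k, Real.exp_pos (-(r * (D ω (k + 1) - D ω k)))]
  set F : Ω → ℝ := fun ω =>
    (missedIndicator (D ω) (epoch (Z ω)) j - Real.exp (-(r * (D ω (j + 1) - D ω j))))
      * (missedIndicator (D ω) (epoch (Z ω)) k - Real.exp (-(r * (D ω (k + 1) - D ω k)))) with hF
  have hFm : Measurable F := ((hMm j).sub (hem j)).mul ((hMm k).sub (hem k))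
  have hFi : Integrable F P := by
    refine Integrable.of_bound hFm.aestronglyMeasurable 1 ?_
    filter_upwards [hb j, hb k] with ω h1 h2
    rw [hF, norm_mul]
    exact mul_le_one₀ h1 (norm_nonneg _) h2
  set B : ℕ → Set Ω := fun n =>
    {ω | (∀ i < n, epoch (Z ω) i < D ω k) ∧ D ω k ≤ epoch (Z ω) n} with hB
  have hBm : ∀ n, MeasurableSet (B n) := fun n => by
    refine MeasurableSet.inter ?_ (measurableSet_le (hDm k) (hτm n))
    refine measurableSet_setOfPred.2 (Measurable.forall fun i => Measurable.imp measurable_const ?_)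
    exact measurableSet_setOfPred.1 (measurableSet_lt (hτm i) (hDm k))
  refine integral_eq_zero_of_partition hFi hBm ?_ ?_ fun n => ?_
  · intro m n hmn
    refine Set.disjoint_left.2 fun ω h1 h2 => ?_
    rcases lt_or_gt_of_ne hmn with h | h
    · exact absurd h1.2 (not_le.2 (h2.1 m h))
    · exact absurd h2.2 (not_le.2 (h1.1 n h))
  · filter_upwards [hτ] with ω h
    have hex : ∃ n, D ω k ≤ epoch (Z ω) n := (h.eventually_ge_atTop _).exists
    exact ⟨Nat.find hex, fun i hi => not_le.1 (Nat.find_min hex hi), Nat.find_spec hex⟩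
  -- `G` looks only at decisions before `n`, hence is unchanged by resampling; it agrees with the
  -- compensated indicator of `j` on `B n` because `D (j + 1) ≤ D k ≤ epoch (Z ω) n`.
  · set G : Ω → ℝ := fun ω => (if ∀ i < n, ¬(D ω j ≤ epoch (Z ω) i ∧ epoch (Z ω) i < D ω (j + 1))
      then 1 else 0) - Real.exp (-(r * (D ω (j + 1) - D ω j))) with hG
    set H : Ω → ℝ := fun ω => if (∀ i < n, epoch (Z ω) i < D ω k) ∧ D ω k ≤ epoch (Z ω) n then
      G ω * ((if D ω (k + 1) ≤ epoch (Z ω) n then 1 else 0)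
        - Real.exp (-(r * (D ω (k + 1) - D ω k)))) else 0 with hH
    have hFH : (B n).indicator F =ᵐ[P] H := by
      filter_upwards [hZ, hD] with ω hZω hDω
      rw [Set.indicator_apply]
      simp only [hB, hH, Set.mem_ofPred_eq]
      by_cases hω : (∀ i < n, epoch (Z ω) i < D ω k) ∧ D ω k ≤ epoch (Z ω) n
      · rw [if_pos hω, if_pos hω]
        have hmono := epoch_mono hZω
        have e1 : Missed (D ω) (epoch (Z ω)) j ↔
            ∀ i < n, ¬(D ω j ≤ epoch (Z ω) i ∧ epoch (Z ω) i < D ω (j + 1)) := by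
          refine ⟨fun h i _ => h i, fun h i hi => ?_⟩
          rcases lt_or_ge i n with hin | hin
          · exact h i hin hi
          · exact absurd hi.2 (not_lt.2 ((hDω hjk).trans (hω.2.trans (hmono hin))))
        have e2 : Missed (D ω) (epoch (Z ω)) k ↔ D ω (k + 1) ≤ epoch (Z ω) n := by
          refine ⟨fun h => not_lt.1 fun h' => h n ⟨hω.2, h'⟩, fun h i hi => ?_⟩
          rcases lt_or_ge i n with hin | hin
          · exact absurd hi.1 (not_le.2 (hω.1 i hin))
          · exact absurd hi.2 (not_lt.2 (h.trans (hmono hin)))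
        simp only [hF, hG, missedIndicator_eq, e1, e2]
      · rw [if_neg hω, if_neg hω]
    rw [integral_congr_ae hFH]
    refine (hR n).integral_eq_zero ((hFi.indicator (hBm n)).congr hFH) ?_
    filter_upwards [hD, hD0] with ω hDω hD0ω
    have hGR : ∀ y, G (R n ω y) = G ω := fun y => by
      simp only [hG, hDR, hZR]
      congr 2
      refine propext (forall₂_congr fun i hi => ?_)
      rw [epoch_update_of_lt _ _ hi]
    have hHR : ∀ y, H (R n ω y) = if ∀ i < n, epoch (Z ω) i < D ω k then
        (if D ω k - ∑ i ∈ Finset.range n, Z ω i ≤ y then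
          (fun x => G ω * ((if D ω (k + 1) - D ω k ≤ x then 1 else 0)
            - Real.exp (-(r * (D ω (k + 1) - D ω k)))))
              (y - (D ω k - ∑ i ∈ Finset.range n, Z ω i)) else 0) else 0 := fun y => by
      have e1 : (∀ i < n, epoch (Function.update (Z ω) n y) i < D ω k)
          ↔ ∀ i < n, epoch (Z ω) i < D ω k :=
        forall₂_congr fun i hi => by rw [epoch_update_of_lt _ _ hi]
      simp only [hH, hGR]
      simp only [hDR, hZR, e1, epoch_update_self]
      rw [ite_and]
      refine if_congr Iff.rfl (if_congr ?_ ?_ rfl) rfl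
      · rw [sub_le_iff_le_add, add_comm]
      · congr 2
        refine if_congr ?_ rfl rfl
        constructor <;> intro h <;> linarith
    simp_rw [hHR]
    split_ifs with hE
    -- The threshold for the gap `n` must be nonnegative for memorylessness: for `n = 0` this is `0
    -- ≤ D ω 0`, otherwise the preceding decision lies before `D ω k`.
    · have ht : 0 ≤ D ω k - ∑ i ∈ Finset.range n, Z ω i := by
        rcases n with _ | n
        · simpa using hD0ω.trans (hDω k.zero_le)
        · exact sub_nonneg.2 (hE n n.lt_succ_self).le
      have hδ : 0 ≤ D ω (k + 1) - D ω k := sub_nonneg.2 (hDω k.le_succ)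
      have hti : Integrable (fun y : ℝ => if D ω (k + 1) - D ω k ≤ y then (1 : ℝ) else 0)
          (expMeasure r) := by
        refine Integrable.of_bound (Measurable.ite measurableSet_Ici measurable_const
          measurable_const).aestronglyMeasurable 1 (ae_of_all _ fun y => ?_)
        split_ifs <;> simp
      refine (integral_expMeasure_residual hr (fun x => G ω *
        ((if D ω (k + 1) - D ω k ≤ x then 1 else 0)
          - Real.exp (-(r * (D ω (k + 1) - D ω k))))) ht).trans ?_
      rw [integral_const_mul,
        integral_sub hti (integrable_const _), integral_expMeasure_tail hr hδ]
      simp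
    · simp

/-- Given the departures, the proportion of missed updates is asymptotically the average of the
probabilities that a Poisson process has no point between successive departures. -/
lemma ae_tendsto_average_missed (hr : 0 < r)
    (hR : ∀ n, Resamples P (expMeasure r) (R n))
    (hZR : ∀ n ω y, Z (R n ω y) = Function.update (Z ω) n y)
    (hDR : ∀ n ω y, D (R n ω y) = D ω)
    (hZm : ∀ n, Measurable fun ω => Z ω n) (hDm : ∀ n, Measurable fun ω => D ω n)
    (hZ : ∀ᵐ ω ∂P, ∀ n, 0 ≤ Z ω n) (hτ : ∀ᵐ ω ∂P, Tendsto (epoch (Z ω)) atTop atTop)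
    (hD : ∀ᵐ ω ∂P, Monotone (D ω)) (hD0 : ∀ᵐ ω ∂P, 0 ≤ D ω 0) :
    ∀ᵐ ω ∂P, Tendsto (fun n : ℕ => (∑ k ∈ Finset.range n,
      (missedIndicator (D ω) (epoch (Z ω)) k - Real.exp (-(r * (D ω (k + 1) - D ω k))))) / n)
      atTop (𝓝 0) := by
  have hτm : ∀ n, Measurable fun ω => epoch (Z ω) n :=
    fun n => (measurable_epoch n).comp (measurable_pi_iff.2 hZm)
  refine ae_tendsto_average_compensated_of_le_one (measurable_missedIndicator hDm hτm) (fun k => ?_)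
    (fun k => ae_of_all _ fun ω => ⟨missedIndicator_nonneg _ _ _, missedIndicator_le_one _ _ _⟩)
    (fun k => ?_)
    (fun j k hjk => integral_missed_compensated_mul hr hR hZR hDR hZm hDm hZ hτ hD hD0 hjk)
  · have h1 := hDm k
    have h2 := hDm (k + 1)
    fun_prop
  · filter_upwards [hD] with ω h
    have h1 : 0 ≤ r * (D ω (k + 1) - D ω k) := mul_nonneg hr.le (sub_nonneg.2 (h k.le_succ))
    refine ⟨(Real.exp_pos _).le, ?_⟩
    rw [Real.exp_le_one_iff]; linarith

end Decisions

/-! ### The bufferless system -/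

lemma blockingDeparture_succ (A S : ℕ → ℝ) (k : ℕ) :
    blockingDeparture A S (k + 1) = A (successful A S (k + 1)) + S (k + 1) := rfl

/-- Divergence of the arrivals makes the defining set nonempty, so `sInf` is a genuine minimum and
not the default 0. -/
lemma successful_succ_spec {A : ℕ → ℝ} (hA : Tendsto A atTop atTop) (S : ℕ → ℝ) (k : ℕ) :
    successful A S k < successful A S (k + 1) ∧
      blockingDeparture A S k ≤ A (successful A S (k + 1)) := by
  have hne : {n | successful A S k < n ∧ A (successful A S k) + S k ≤ A n}.Nonempty :=
    ((eventually_gt_atTop _).and (hA.eventually_ge_atTop _)).exists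
  exact Nat.sInf_mem hne

lemma lt_blockingDeparture_of_lt {A S : ℕ → ℝ} {k i : ℕ} (h1 : successful A S k < i)
    (h2 : i < successful A S (k + 1)) : A i < blockingDeparture A S k := by
  by_contra h
  exact Nat.notMem_of_lt_sInf h2 ⟨h1, not_lt.1 h⟩

lemma successful_succ_eq {A S : ℕ → ℝ} {k n : ℕ} (h1 : successful A S k < n)
    (h2 : ∀ i < n, successful A S k < i → A i < blockingDeparture A S k)
    (h3 : blockingDeparture A S k ≤ A n) : successful A S (k + 1) = n := by
  refine le_antisymm (Nat.sInf_le ⟨h1, h3⟩) (le_csInf ⟨n, h1, h3⟩ fun i hi => ?_)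
  by_contra h
  exact absurd (h2 i (not_le.1 h) hi.1) (not_lt.2 hi.2)

lemma blockingDeparture_mono {A S : ℕ → ℝ} (hA : Tendsto A atTop atTop) (hS : ∀ n, 0 ≤ S n) :
    Monotone (blockingDeparture A S) :=
  monotone_nat_of_le_succ fun k => by
    rw [blockingDeparture_succ]
    linarith [(successful_succ_spec hA S k).2, hS (k + 1)]

lemma tendsto_blockingDeparture {A S : ℕ → ℝ} (hA : Tendsto A atTop atTop) (hS : ∀ n, 0 ≤ S n) :
    Tendsto (blockingDeparture A S) atTop atTop := by
  have h : StrictMono (successful A S) :=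
    strictMono_nat_of_lt_succ fun k => (successful_succ_spec hA S k).1
  refine tendsto_atTop_mono (fun k => ?_) (hA.comp h.tendsto_atTop)
  exact le_add_of_nonneg_right (hS k)

/-- Before its last value, the sequence of successful updates only depends on the arrivals up to
that value. -/
lemma successful_congr {A A' S : ℕ → ℝ} {k n : ℕ} (hA : ∀ i < n, A' i = A i)
    (hs : ∀ i < k, successful A S i < successful A S (i + 1)) (hn : successful A S k < n) :
    ∀ i ≤ k, successful A' S i = successful A S i ∧ successful A S i < n := by
  have hlt : ∀ i ≤ k, successful A S i < n := by
    intro i hi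
    have : ∀ j, i ≤ j → j ≤ k → successful A S i ≤ successful A S j := by
      intro j hij
      induction j, hij using Nat.le_induction with
      | base => exact fun _ => le_rfl
      | succ j _ ih => exact fun hj => (ih (by omega)).trans (hs j (by omega)).le
    exact (this k hi le_rfl).trans_lt hn
  intro i
  induction i with
  | zero => exact fun hi => ⟨rfl, hlt 0 hi⟩
  | succ i ih =>
    intro hi
    have hi' := (ih (by omega)).1
    have hD : blockingDeparture A' S i = blockingDeparture A S i := by
      rw [blockingDeparture, blockingDeparture, hi', hA _ (hlt i (by omega))]
    refine ⟨successful_succ_eq ?_ ?_ ?_, hlt _ hi⟩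
    · rw [hi']; exact hs i (by omega)
    · intro l hl hl'
      rw [hi'] at hl'
      rw [hD, hA l (hl.trans (hlt _ hi))]
      exact lt_blockingDeparture_of_lt hl' hl
    · rw [hD, hA _ (hlt _ hi)]
      -- An empty set would give the default `sInf ∅ = 0`, which the strict increase in `hs` rules
      -- out.
      have hne : {n | successful A S i < n ∧ A (successful A S i) + S i ≤ A n}.Nonempty := by
        by_contra hne
        have h0 : successful A S (i + 1) = 0 := by
          rw [successful, Set.not_nonempty_iff_eq_empty.1 hne, Nat.sInf_empty]
        have := hs i (by omega)
        omega
      exact (Nat.sInf_mem hne).2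

lemma blockingDeparture_congr {A A' S : ℕ → ℝ} {k n : ℕ} (hA : ∀ i < n, A' i = A i)
    (hs : ∀ i < k, successful A S i < successful A S (i + 1)) (hn : successful A S k < n)
    {i : ℕ} (hi : i ≤ k) : blockingDeparture A' S i = blockingDeparture A S i := by
  obtain ⟨h1, h2⟩ := successful_congr hA hs hn i hi
  rw [blockingDeparture, blockingDeparture, h1, hA _ h2]

/-- All generated updates with index in `(s k, n)` find the server busy with the `k`-th successful
update, where `s` is the sequence of the successful indices. -/
def BusyBefore (A S : ℕ → ℝ) (k n : ℕ) : Prop :=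
  (∀ i < k, successful A S i < successful A S (i + 1)) ∧ successful A S k < n ∧
    ∀ i < n, successful A S k < i → A i < blockingDeparture A S k

/-- The event is decided by the arrivals before `n`, so resampling the gap `n` preserves it. -/
lemma BusyBefore.congr {A A' S : ℕ → ℝ} {k n : ℕ} (hA : ∀ i < n, A' i = A i)
    (h : BusyBefore A S k n) : BusyBefore A' S k n := by
  have hs := successful_congr hA h.1 h.2.1
  refine ⟨fun i hi => ?_, ?_, fun i hi hki => ?_⟩
  · rw [(hs i hi.le).1, (hs (i + 1) hi).1]; exact h.1 i hi
  · rw [(hs k le_rfl).1]; exact h.2.1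
  · rw [(hs k le_rfl).1] at hki
    rw [hA i hi, blockingDeparture_congr hA h.1 h.2.1 le_rfl]
    exact h.2.2 i hi hki

lemma busyBefore_congr {A A' S : ℕ → ℝ} {k n : ℕ} (hA : ∀ i < n, A' i = A i) :
    BusyBefore A' S k n ↔ BusyBefore A S k n :=
  ⟨BusyBefore.congr fun i hi => (hA i hi).symm, BusyBefore.congr hA⟩

section Measurability

variable {Ω : Type*} [MeasurableSpace Ω]

lemma measurable_sInf_nat {p : Ω → ℕ → Prop} (hp : ∀ n, MeasurableSet {ω | p ω n}) :
    Measurable fun ω => sInf {n | p ω n} := by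
  classical
  refine measurable_to_countable' fun m => ?_
  have hF : MeasurableSet {ω | p ω m ∧ ∀ i < m, ¬p ω i} := by
    refine (hp m).inter (measurableSet_setOfPred.2 (Measurable.forall fun i =>
      Measurable.imp measurable_const ?_))
    exact (measurableSet_setOfPred.1 (hp i)).not
  -- The default value of `sInf ∅` puts the outcomes without any admissible index into the fibre
  -- over 0.
  have hE : MeasurableSet {ω | m = 0 ∧ ∀ i, ¬p ω i} := by
    refine measurableSet_setOfPred.2 (Measurable.and measurable_const
      (Measurable.forall fun i => ?_))
    exact (measurableSet_setOfPred.1 (hp i)).not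
  convert hF.union hE using 1
  ext ω
  simp only [Set.mem_preimage, Set.mem_singleton_iff, Set.mem_union, Set.mem_ofPred_eq]
  by_cases hne : {n | p ω n}.Nonempty
  · constructor
    · rintro rfl
      exact Or.inl ⟨Nat.sInf_mem hne, fun i hi => Nat.notMem_of_lt_sInf hi⟩
    · rintro (⟨h1, h2⟩ | ⟨-, h2⟩)
      · refine le_antisymm (Nat.sInf_le h1) (le_csInf hne fun i hi => ?_)
        by_contra h
        exact h2 i (not_le.1 h) hi
      · obtain ⟨i, hi⟩ := hne
        exact absurd hi (h2 i)
  · have he : ∀ i, ¬p ω i := fun i hi => hne ⟨i, hi⟩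
    rw [Set.not_nonempty_iff_eq_empty.1 hne, Nat.sInf_empty]
    simp [he, eq_comm]

lemma measurable_eval_nat {A : Ω → ℕ → ℝ} (hA : ∀ n, Measurable fun ω => A ω n) {s : Ω → ℕ}
    (hs : Measurable s) : Measurable fun ω => A ω (s ω) := by
  have : Measurable fun q : Ω × ℕ => A q.1 q.2 := measurable_from_prod_countable_left hA
  exact this.comp (measurable_id.prodMk hs)

lemma measurable_successful {A S : Ω → ℕ → ℝ} (hA : ∀ n, Measurable fun ω => A ω n)
    (hS : ∀ n, Measurable fun ω => S ω n) (k : ℕ) :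
    Measurable fun ω => successful (A ω) (S ω) k := by
  induction k with
  | zero => exact measurable_const
  | succ k ih =>
    refine measurable_sInf_nat fun n => ?_
    exact (measurableSet_lt ih measurable_const).inter
      (measurableSet_le ((measurable_eval_nat hA ih).add (hS k)) (hA n))

lemma measurable_blockingDeparture {A S : Ω → ℕ → ℝ} (hA : ∀ n, Measurable fun ω => A ω n)
    (hS : ∀ n, Measurable fun ω => S ω n) (k : ℕ) :
    Measurable fun ω => blockingDeparture (A ω) (S ω) k :=
  (measurable_eval_nat hA (measurable_successful hA hS k)).add (hS k)

lemma measurableSet_busyBefore {A S : Ω → ℕ → ℝ} (hA : ∀ n, Measurable fun ω => A ω n)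
    (hS : ∀ n, Measurable fun ω => S ω n) (k n : ℕ) :
    MeasurableSet {ω | BusyBefore (A ω) (S ω) k n} := by
  have hs := measurable_successful hA hS
  refine MeasurableSet.inter ?_ (MeasurableSet.inter ?_ ?_)
  · refine measurableSet_setOfPred.2 (Measurable.forall fun i =>
      Measurable.imp measurable_const ?_)
    exact measurableSet_setOfPred.1 (measurableSet_lt (hs i) (hs (i + 1)))
  · exact measurableSet_lt (hs k) measurable_const
  · refine measurableSet_setOfPred.2 (Measurable.forall fun i =>
      Measurable.imp measurable_const (Measurable.imp ?_ ?_))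
    · exact measurableSet_setOfPred.1 (measurableSet_lt (hs k) measurable_const)
    · exact measurableSet_setOfPred.1
        (measurableSet_lt (hA i) (measurable_blockingDeparture hA hS k))

end Measurability

section Blocking

variable {Ω : Type*} [MeasurableSpace Ω] {P : Measure Ω} [IsProbabilityMeasure P]
  {X S : Ω → ℕ → ℝ} {R : ℕ → Ω → ℝ → Ω} {r s : ℝ}

/-- Partition by the index `n` of the successful update `k + 1`. The departures up to the `k`-th and
the event `BusyBefore` ignore the gap `n`, and the remaining condition is that this gap exceeds a
threshold. By memorylessness the idle time is then exponential, with transform `r / (r + s)` at `s`.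
-/
lemma integral_blocking_compensated_mul (hr : 0 < r) (hs : 0 < s)
    (hR : ∀ n, Resamples P (expMeasure r) (R n))
    (hXR : ∀ n ω y, X (R n ω y) = Function.update (X ω) n y)
    (hSR : ∀ n ω y, S (R n ω y) = S ω)
    (hXm : ∀ n, Measurable fun ω => X ω n) (hSm : ∀ n, Measurable fun ω => S ω n)
    (hA : ∀ᵐ ω ∂P, Tendsto (epoch (X ω)) atTop atTop)
    (hS : ∀ᵐ ω ∂P, ∀ n, 0 ≤ S ω n) {j k : ℕ} (hjk : j < k) :
    ∫ ω, (Real.exp (-(s * (blockingDeparture (epoch (X ω)) (S ω) (j + 1)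
        - blockingDeparture (epoch (X ω)) (S ω) j)))
        - Real.exp (-(s * S ω (j + 1))) * (r / (r + s)))
      * (Real.exp (-(s * (blockingDeparture (epoch (X ω)) (S ω) (k + 1)
        - blockingDeparture (epoch (X ω)) (S ω) k)))
        - Real.exp (-(s * S ω (k + 1))) * (r / (r + s))) ∂P = 0 := by
  classical
  have := isProbabilityMeasure_expMeasure hr
  have hAm : ∀ n, Measurable fun ω => epoch (X ω) n :=
    fun n => (measurable_epoch n).comp (measurable_pi_iff.2 hXm)
  have hDm := measurable_blockingDeparture hAm hSm
  set D : Ω → ℕ → ℝ := fun ω => blockingDeparture (epoch (X ω)) (S ω) with hD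
  set U : ℕ → Ω → ℝ := fun k ω => Real.exp (-(s * (D ω (k + 1) - D ω k)))
    - Real.exp (-(s * S ω (k + 1))) * (r / (r + s)) with hU
  have hUm : ∀ k, Measurable (U k) := fun k => by
    have h1 : Measurable fun ω => D ω k := hDm k
    have h2 : Measurable fun ω => D ω (k + 1) := hDm (k + 1)
    have h3 := hSm (k + 1)
    fun_prop
  have hb : ∀ k, ∀ᵐ ω ∂P, ‖U k ω‖ ≤ 1 := fun k => by
    filter_upwards [hA, hS] with ω hA hS
    have h1 : 0 ≤ s * (D ω (k + 1) - D ω k) :=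
      mul_nonneg hs.le (sub_nonneg.2 (blockingDeparture_mono hA hS k.le_succ))
    have h2 : Real.exp (-(s * (D ω (k + 1) - D ω k))) ≤ 1 := by
      rw [Real.exp_le_one_iff]; linarith
    have h3 : Real.exp (-(s * S ω (k + 1))) ≤ 1 := by
      rw [Real.exp_le_one_iff]
      linarith [mul_nonneg hs.le (hS (k + 1))]
    have h4 : r / (r + s) ≤ 1 := (div_le_one (by positivity)).2 (by linarith)
    have h5 : Real.exp (-(s * S ω (k + 1))) * (r / (r + s)) ≤ 1 :=
      mul_le_one₀ h3 (by positivity) h4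
    have h6 : 0 ≤ Real.exp (-(s * S ω (k + 1))) * (r / (r + s)) := by positivity
    rw [Real.norm_eq_abs, abs_le]
    constructor <;> linarith [Real.exp_pos (-(s * (D ω (k + 1) - D ω k)))]
  set F : Ω → ℝ := fun ω => U j ω * U k ω with hF
  have hFi : Integrable F P := by
    refine Integrable.of_bound ((hUm j).mul (hUm k)).aestronglyMeasurable 1 ?_
    filter_upwards [hb j, hb k] with ω h1 h2
    rw [norm_mul]
    exact mul_le_one₀ h1 (norm_nonneg _) h2
  set B : ℕ → Set Ω := fun n =>
    {ω | BusyBefore (epoch (X ω)) (S ω) k n ∧ D ω k ≤ epoch (X ω) n} with hB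
  have hBm : ∀ n, MeasurableSet (B n) := fun n =>
    (measurableSet_busyBefore hAm hSm k n).inter (measurableSet_le (hDm k) (hAm n))
  refine integral_eq_zero_of_partition hFi hBm ?_ ?_ fun n => ?_
  · intro m n hmn
    refine Set.disjoint_left.2 fun ω h1 h2 => ?_
    rcases lt_or_gt_of_ne hmn with h | h
    · exact absurd h1.2 (not_le.2 (h2.1.2.2 m h h1.1.2.1))
    · exact absurd h2.2 (not_le.2 (h1.1.2.2 n h h2.1.2.1))
  · filter_upwards [hA] with ω h
    refine ⟨successful (epoch (X ω)) (S ω) (k + 1), ⟨fun i _ => ?_, ?_, fun i hi hki => ?_⟩, ?_⟩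
    · exact (successful_succ_spec h (S ω) i).1
    · exact (successful_succ_spec h (S ω) k).1
    · exact lt_blockingDeparture_of_lt hki hi
    · exact (successful_succ_spec h (S ω) k).2
  · set H : Ω → ℝ := fun ω => if BusyBefore (epoch (X ω)) (S ω) k n ∧ D ω k ≤ epoch (X ω) n then
      U j ω * (Real.exp (-(s * S ω (k + 1))) *
        (Real.exp (-(s * (epoch (X ω) n - D ω k))) - r / (r + s))) else 0 with hH
    have hFH : (B n).indicator F = H := by
      funext ω
      rw [Set.indicator_apply]
      simp only [hB, hH, Set.mem_ofPred_eq]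
      by_cases hω : BusyBefore (epoch (X ω)) (S ω) k n ∧ D ω k ≤ epoch (X ω) n
      · rw [if_pos hω, if_pos hω]
        have e : D ω (k + 1) = epoch (X ω) n + S ω (k + 1) := by
          simp only [hD, blockingDeparture_succ]
          rw [successful_succ_eq hω.1.2.1 hω.1.2.2 hω.2]
        simp only [hF]
        congr 1
        simp only [hU, e]
        rw [mul_sub (Real.exp _), ← Real.exp_add]
        ring_nf
      · rw [if_neg hω, if_neg hω]
    rw [hFH]
    refine (hR n).integral_eq_zero (hFH ▸ hFi.indicator (hBm n)) ?_
    filter_upwards [hS] with ω hSω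
    have hAR : ∀ y, ∀ i < n, epoch (Function.update (X ω) n y) i = epoch (X ω) i :=
      fun y i hi => epoch_update_of_lt _ _ hi
    by_cases hE : BusyBefore (epoch (X ω)) (S ω) k n
    · have hDR : ∀ y, ∀ i ≤ k, D (R n ω y) i = D ω i := fun y i hi => by
        simp only [hD, hXR, hSR]
        exact blockingDeparture_congr (hAR y) hE.1 hE.2.1 hi
      have hUR : ∀ y, U j (R n ω y) = U j ω := fun y => by
        simp only [hU]
        rw [hDR y j hjk.le, hDR y (j + 1) hjk, hSR]
      set t := D ω k - ∑ i ∈ Finset.range n, X ω i with ht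
      have hHR : ∀ y, H (R n ω y) = if t ≤ y then
          (fun x => U j ω * (Real.exp (-(s * S ω (k + 1))) *
            (Real.exp (-(s * x)) - r / (r + s)))) (y - t) else 0 := fun y => by
        simp only [hH]
        rw [hUR, hDR y k le_rfl, hSR, hXR, epoch_update_self]
        refine if_congr ?_ ?_ rfl
        · rw [busyBefore_congr (hAR y), ht, sub_le_iff_le_add, add_comm]
          exact and_iff_right hE
        · rw [ht, sub_sub_eq_add_sub, add_comm y]
      -- The arrival preceding `n` either found the server busy with update `k` or is update `k`
      -- itself; in both cases it is no later than `D ω k`.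
      have ht0 : 0 ≤ t := by
        have hn := hE.2.1
        rcases n with _ | n
        · omega
        · refine sub_nonneg.2 ?_
          rcases (Nat.lt_succ_iff.1 hn).lt_or_eq with h | h
          · exact (hE.2.2 n n.lt_succ_self h).le
          · have : D ω k = epoch (X ω) n + S ω k := by
              simp only [hD, blockingDeparture, h]
            rw [this]
            exact le_add_of_nonneg_right (hSω k)
      simp_rw [hHR]
      refine (integral_expMeasure_residual hr (fun x => U j ω * (Real.exp (-(s * S ω (k + 1))) *
            (Real.exp (-(s * x)) - r / (r + s)))) ht0).trans ?_
      rw [integral_const_mul, integral_const_mul,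
        integral_sub (integrable_exp_neg_expMeasure hr hs) (integrable_const _),
        integral_exp_neg_expMeasure hr hs]
      simp
    · have hHR : ∀ y, H (R n ω y) = 0 := fun y => by
        simp only [hH]
        refine if_neg fun h => hE ?_
        rw [hXR, hSR] at h
        exact (busyBefore_congr (hAR y)).1 h.1
      simp [hHR]

/-- In the bufferless system the server stays idle, after each service, for an exponential time
that is independent of the past. -/
lemma ae_tendsto_average_blocking (hr : 0 < r) (hs : 0 < s)
    (hR : ∀ n, Resamples P (expMeasure r) (R n))
    (hXR : ∀ n ω y, X (R n ω y) = Function.update (X ω) n y)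
    (hSR : ∀ n ω y, S (R n ω y) = S ω)
    (hXm : ∀ n, Measurable fun ω => X ω n) (hSm : ∀ n, Measurable fun ω => S ω n)
    (hA : ∀ᵐ ω ∂P, Tendsto (epoch (X ω)) atTop atTop)
    (hS : ∀ᵐ ω ∂P, ∀ n, 0 ≤ S ω n) :
    ∀ᵐ ω ∂P, Tendsto (fun n : ℕ => (∑ k ∈ Finset.range n,
      (Real.exp (-(s * (blockingDeparture (epoch (X ω)) (S ω) (k + 1)
        - blockingDeparture (epoch (X ω)) (S ω) k)))
        - Real.exp (-(s * S ω (k + 1))) * (r / (r + s)))) / n) atTop (𝓝 0) := by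
  have hAm : ∀ n, Measurable fun ω => epoch (X ω) n :=
    fun n => (measurable_epoch n).comp (measurable_pi_iff.2 hXm)
  have hDm := measurable_blockingDeparture hAm hSm
  refine ae_tendsto_average_compensated_of_le_one (fun k => ?_) (fun k => ?_) (fun k => ?_)
    (fun k => ?_)
    (fun j k hjk => integral_blocking_compensated_mul hr hs hR hXR hSR hXm hSm hA hS hjk)
  · have h1 := hDm k
    have h2 := hDm (k + 1)
    fun_prop
  · have h3 := hSm (k + 1)
    fun_prop
  · filter_upwards [hA, hS] with ω hA hS
    have h1 := mul_nonneg hs.le (sub_nonneg.2 (blockingDeparture_mono hA hS k.le_succ))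
    refine ⟨(Real.exp_pos _).le, ?_⟩
    rw [Real.exp_le_one_iff]; linarith
  · filter_upwards [hS] with ω hS
    have h3 : Real.exp (-(s * S ω (k + 1))) ≤ 1 := by
      rw [Real.exp_le_one_iff]
      linarith [mul_nonneg hs.le (hS (k + 1))]
    have h4 : r / (r + s) ≤ 1 := (div_le_one (by positivity)).2 (by linarith)
    exact ⟨by positivity, mul_le_one₀ h3 (by positivity) h4⟩

end Blocking

/-! ### The system with an infinite buffer -/

lemma fcfsDeparture_succ (A S : ℕ → ℝ) (k : ℕ) :
    fcfsDeparture A S (k + 1) = max (fcfsDeparture A S k) (A (k + 1)) + S (k + 1) := rfl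

lemma fcfsDeparture_congr {A A' S S' : ℕ → ℝ} {k : ℕ} (hA : ∀ i ≤ k, A' i = A i)
    (hS : ∀ i ≤ k, S' i = S i) : fcfsDeparture A' S' k = fcfsDeparture A S k := by
  induction k with
  | zero => simp [fcfsDeparture, hA 0 le_rfl, hS 0 le_rfl]
  | succ k ih =>
    rw [fcfsDeparture_succ, fcfsDeparture_succ, hA _ le_rfl, hS _ le_rfl,
      ih (fun i hi => hA i (by omega)) fun i hi => hS i (by omega)]

/-- The time that the `k`-th update spends in the system with an infinite buffer. -/
noncomputable def sojourn (X S : ℕ → ℝ) (k : ℕ) : ℝ := fcfsDeparture (epoch X) S k - epoch X k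

/-- The time that the server of the system with an infinite buffer is idle just before it serves
the update with index `k + 1`. -/
noncomputable def idle (X S : ℕ → ℝ) (k : ℕ) : ℝ := max (X (k + 1) - sojourn X S k) 0

lemma idle_nonneg (X S : ℕ → ℝ) (k : ℕ) : 0 ≤ idle X S k := le_max_right _ _

/-- Splits the inter-departure time into an idle part and a service, so that its discount becomes a
product. -/
lemma fcfsDeparture_succ_eq (X S : ℕ → ℝ) (k : ℕ) :
    fcfsDeparture (epoch X) S (k + 1) = fcfsDeparture (epoch X) S k + idle X S k + S (k + 1) := by
  rw [fcfsDeparture_succ, idle, sojourn, epoch_succ, ← max_add_add_left]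
  rw [add_zero, max_comm]
  congr 2
  ring

lemma le_sojourn {X S : ℕ → ℝ} (k : ℕ) : S k ≤ sojourn X S k := by
  rw [sojourn, le_sub_iff_add_le, add_comm]
  rcases k with _ | k
  · exact le_rfl
  · rw [fcfsDeparture_succ]
    gcongr
    exact le_max_right _ _

lemma fcfsDeparture_mono {X S : ℕ → ℝ} (hS : ∀ n, 0 ≤ S n) :
    Monotone (fcfsDeparture (epoch X) S) :=
  monotone_nat_of_le_succ fun k => by
    rw [fcfsDeparture_succ_eq]
    linarith [idle_nonneg X S k, hS (k + 1)]

lemma tendsto_fcfsDeparture {X S : ℕ → ℝ} (hS : ∀ n, 0 ≤ S n)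
    (hA : Tendsto (epoch X) atTop atTop) :
    Tendsto (fcfsDeparture (epoch X) S) atTop atTop := by
  refine tendsto_atTop_mono (fun k => ?_) hA
  have : 0 ≤ sojourn X S k := (hS k).trans (le_sojourn k)
  rw [sojourn] at this
  linarith

/-- At every instant the server is either idle or serving, which expresses the sojourn time through
the cumulative idle time. -/
lemma fcfsDeparture_eq (X S : ℕ → ℝ) (n : ℕ) :
    fcfsDeparture (epoch X) S n
      = epoch X 0 + ∑ i ∈ Finset.range (n + 1), S i + ∑ k ∈ Finset.range n, idle X S k := by
  induction n with
  | zero => simp [fcfsDeparture]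
  | succ n ih =>
    rw [fcfsDeparture_succ_eq, ih, Finset.sum_range_succ S (n + 1),
      Finset.sum_range_succ (idle X S) n]
    ring

/-- The long-run average idle time per served update. -/
lemma tendsto_average_idle {X S : ℕ → ℝ} {a b : ℝ}
    (hX : Tendsto (fun n : ℕ => (∑ i ∈ Finset.range n, X (i + 1)) / n) atTop (𝓝 a))
    (hS : Tendsto (fun n : ℕ => (∑ i ∈ Finset.range n, S i) / n) atTop (𝓝 b)) :
    Tendsto (fun n : ℕ => (∑ k ∈ Finset.range n, idle X S k) / n) atTop (𝓝 (max (a - b) 0)) := by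
  -- Cumulative idle time is the running maximum, from value 0, of total interarrival time minus
  -- total service time. This reflection identity holds for every load.
  refine tendsto_runningMax_div
    (u := fun n => ∑ i ∈ Finset.range n, X (i + 1) - ∑ i ∈ Finset.range n, S i) (by simp)
    (fun n => ?_) ?_
  · have h : epoch X n = epoch X 0 + ∑ i ∈ Finset.range n, X (i + 1) := by
      simp only [epoch, zero_add, Finset.sum_range_one]
      rw [Finset.sum_range_succ' X n, add_comm]
    rw [Finset.sum_range_succ, idle, sojourn, fcfsDeparture_eq, h, ← max_add_add_left, add_zero,
      max_comm]
    congr 1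
    rw [Finset.sum_range_succ (fun i => X (i + 1))]
    ring
  · refine (hX.sub hS).congr fun n => ?_
    rw [sub_div]

lemma sojourn_congr {X X' S S' : ℕ → ℝ} {k : ℕ} (hX : ∀ i ≤ k, epoch X' i = epoch X i)
    (hS : ∀ i ≤ k, S' i = S i) : sojourn X' S' k = sojourn X S k := by
  rw [sojourn, sojourn, fcfsDeparture_congr hX hS, hX k le_rfl]

lemma sojourn_update_arrival (X S : ℕ → ℝ) (y : ℝ) {k n : ℕ} (h : k < n) :
    sojourn (Function.update X n y) S k = sojourn X S k :=
  sojourn_congr (fun _ hi => epoch_update_of_lt _ _ (hi.trans_lt h)) fun _ _ => rfl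

lemma sojourn_update_service (X S : ℕ → ℝ) (y : ℝ) {k n : ℕ} (h : k < n) :
    sojourn X (Function.update S n y) k = sojourn X S k :=
  sojourn_congr (fun _ _ => rfl) fun _ hi => Function.update_of_ne (hi.trans_lt h).ne _ _

lemma idle_update_arrival (X S : ℕ → ℝ) (y : ℝ) {k n : ℕ} (h : k + 1 < n) :
    idle (Function.update X n y) S k = idle X S k := by
  rw [idle, idle, sojourn_update_arrival _ _ _ (by omega), Function.update_of_ne h.ne]

lemma idle_update_arrival_self (X S : ℕ → ℝ) (y : ℝ) (k : ℕ) :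
    idle (Function.update X (k + 1) y) S k = max (y - sojourn X S k) 0 := by
  rw [idle, sojourn_update_arrival _ _ _ k.lt_succ_self, Function.update_self]

section FCFS

variable {Ω : Type*} [MeasurableSpace Ω] {P : Measure Ω} [IsProbabilityMeasure P]
  {X S : Ω → ℕ → ℝ} {R : ℕ → Ω → ℝ → Ω} {r s : ℝ}

lemma measurable_fcfsDeparture {A S : Ω → ℕ → ℝ} (hA : ∀ n, Measurable fun ω => A ω n)
    (hS : ∀ n, Measurable fun ω => S ω n) (k : ℕ) :
    Measurable fun ω => fcfsDeparture (A ω) (S ω) k := by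
  induction k with
  | zero => exact (hA 0).add (hS 0)
  | succ k ih => exact (ih.max (hA (k + 1))).add (hS (k + 1))

lemma measurable_sojourn (hX : ∀ n, Measurable fun ω => X ω n)
    (hS : ∀ n, Measurable fun ω => S ω n) (k : ℕ) :
    Measurable fun ω => sojourn (X ω) (S ω) k := by
  have hA : ∀ n, Measurable fun ω => epoch (X ω) n :=
    fun n => (measurable_epoch n).comp (measurable_pi_iff.2 hX)
  exact (measurable_fcfsDeparture hA hS k).sub (hA k)

lemma measurable_idle (hX : ∀ n, Measurable fun ω => X ω n)
    (hS : ∀ n, Measurable fun ω => S ω n) (k : ℕ) :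
    Measurable fun ω => idle (X ω) (S ω) k :=
  ((hX (k + 1)).sub (measurable_sojourn hX hS k)).max measurable_const

/-- The idle times have the same averages as their conditional means given the past. -/
lemma ae_tendsto_average_idle (hr : 0 < r)
    (hR : ∀ n, Resamples P (expMeasure r) (R n))
    (hXR : ∀ n ω y, X (R n ω y) = Function.update (X ω) n y)
    (hSR : ∀ n ω y, S (R n ω y) = S ω)
    (hXl : ∀ n, MeasurePreserving (fun ω => X ω n) P (expMeasure r))
    (hSm : ∀ n, Measurable fun ω => S ω n) (hS : ∀ᵐ ω ∂P, ∀ n, 0 ≤ S ω n) :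
    ∀ᵐ ω ∂P, Tendsto (fun n : ℕ => (∑ k ∈ Finset.range n,
      (idle (X ω) (S ω) k - Real.exp (-(r * sojourn (X ω) (S ω) k)) / r)) / n) atTop (𝓝 0) := by
  have := isProbabilityMeasure_expMeasure hr
  have hXm : ∀ n, Measurable fun ω => X ω n := fun n => (hXl n).measurable
  have hVm := measurable_sojourn hXm hSm
  have hIm := measurable_idle hXm hSm
  have hX : ∀ n, ∀ᵐ ω ∂P, 0 ≤ X ω n := fun n =>
    (hXl n).quasiMeasurePreserving.ae (ae_nonneg_expMeasure r)
  have he : ∀ k, ∀ᵐ ω ∂P, 0 ≤ Real.exp (-(r * sojourn (X ω) (S ω) k)) / r ∧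
      Real.exp (-(r * sojourn (X ω) (S ω) k)) / r ≤ 1 / r := fun k => by
    filter_upwards [hS] with ω h
    refine ⟨by positivity, ?_⟩
    gcongr
    rw [Real.exp_le_one_iff]
    linarith [mul_nonneg hr.le ((h k).trans (le_sojourn (X := X ω) k))]
  set W : ℕ → Ω → ℝ := fun k ω =>
    idle (X ω) (S ω) k - Real.exp (-(r * sojourn (X ω) (S ω) k)) / r with hW
  have hWm : ∀ k, Measurable (W k) := fun k => by
    have h1 := hVm k
    have h2 := hIm k
    fun_prop
  -- Idle times are unbounded, but `idle ≤ X (k + 1)` and the compensator is at most `1 / r`; then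
  -- `g` comes from `(x + 1/r)² ≤ 2x² + 2/r²`.
  set g : ℝ → ℝ := fun x => 2 * x ^ 2 + 2 / r ^ 2 with hg
  have hgi : Integrable g (expMeasure r) :=
    ((integrable_pow_expMeasure hr 2).const_mul 2).add (integrable_const _)
  have hgP : ∀ k, Integrable (fun ω => g (X ω (k + 1))) P := fun k =>
    ((hXl (k + 1)).integrable_comp hgi.aestronglyMeasurable).2 hgi
  have hWb : ∀ k, ∀ᵐ ω ∂P, W k ω ^ 2 ≤ g (X ω (k + 1)) := fun k => by
    filter_upwards [hX (k + 1), he k, hS] with ω h1 h2 h3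
    have hV : 0 ≤ sojourn (X ω) (S ω) k := (h3 k).trans (le_sojourn k)
    have h4 : idle (X ω) (S ω) k ≤ X ω (k + 1) := max_le (by linarith) h1
    have h5 := idle_nonneg (X ω) (S ω) k
    have h6 : W k ω ^ 2 ≤ (X ω (k + 1) + 1 / r) ^ 2 := by
      refine sq_le_sq' ?_ ?_
      · simp only [hW]; linarith
      · simp only [hW]; linarith
    refine h6.trans ?_
    simp only [hg]
    have : 2 / r ^ 2 = 2 * (1 / r) ^ 2 := by rw [one_div_pow, mul_one_div]
    rw [this]
    nlinarith [sq_nonneg (X ω (k + 1) - 1 / r)]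
  have hL : ∀ k, MemLp (W k) 2 P := fun k => by
    rw [memLp_two_iff_integrable_sq (hWm k).aestronglyMeasurable]
    refine (hgP k).mono' ((hWm k).pow_const 2).aestronglyMeasurable ?_
    filter_upwards [hWb k] with ω h
    rwa [Real.norm_of_nonneg (sq_nonneg _)]
  refine ae_tendsto_average_compensated (B := 1 / r) (C := ∫ x, g x ∂expMeasure r)
    (fun k => ae_of_all _ fun ω => idle_nonneg _ _ _) he hL (fun k => ?_) fun j k hjk => ?_
  · have h1 : ∫ ω, g (X ω (k + 1)) ∂P = ∫ x, g x ∂expMeasure r := by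
      rw [← (hXl (k + 1)).map_eq, integral_map (hXl (k + 1)).aemeasurable]
      rw [(hXl (k + 1)).map_eq]
      exact hgi.aestronglyMeasurable
    rw [← h1]
    exact integral_mono_ae (hL k).integrable_sq (hgP k) (hWb k)
  -- The gap `k + 1` enters only through `idle k`: the sojourn of `k` and the whole term `j < k` use
  -- earlier gaps.
  · refine (hR (k + 1)).integral_eq_zero ((hL j).integrable_mul (hL k)) ?_
    filter_upwards [hS] with ω h
    have hV : 0 ≤ sojourn (X ω) (S ω) k := (h k).trans (le_sojourn k)
    have e : ∀ y, W j (R (k + 1) ω y) * W k (R (k + 1) ω y) = W j ω * (max (y - sojourn (X ω) (S ω) k) 0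
        - Real.exp (-(r * sojourn (X ω) (S ω) k)) / r) := fun y => by
      simp only [hW, hXR, hSR]
      rw [idle_update_arrival _ _ _ (by omega), sojourn_update_arrival _ _ _ (by omega),
        idle_update_arrival_self, sojourn_update_arrival _ _ _ (by omega)]
    have hi : Integrable (fun y => max (y - sojourn (X ω) (S ω) k) 0) (expMeasure r) := by
      by_contra hni
      have h0 := integral_undef hni
      rw [integral_max_sub_expMeasure hr hV] at h0
      have : 0 < Real.exp (-(r * sojourn (X ω) (S ω) k)) / r := by positivity
      linarith
    refine (integral_congr_ae (ae_of_all _ e)).trans ?_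
    rw [integral_const_mul, integral_sub hi (integrable_const _),
      integral_max_sub_expMeasure hr hV]
    simp

lemma one_sub_mem_Icc (hr : 0 < r) (hs : 0 < s) {v : ℝ} (hv : 0 ≤ v) :
    0 ≤ 1 - s / (r + s) * Real.exp (-(r * v)) ∧ 1 - s / (r + s) * Real.exp (-(r * v)) ≤ 1 := by
  have h1 : Real.exp (-(r * v)) ≤ 1 := by
    rw [Real.exp_le_one_iff]
    linarith [mul_nonneg hr.le hv]
  have h2 : s / (r + s) ≤ 1 := (div_le_one (by positivity)).2 (by linarith)
  have h3 : s / (r + s) * Real.exp (-(r * v)) ≤ 1 := mul_le_one₀ h2 (Real.exp_pos _).le h1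
  have h4 : 0 ≤ s / (r + s) * Real.exp (-(r * v)) := by positivity
  constructor <;> linarith

/-- Averaging the next arrival out of the discounted time between departures. -/
lemma ae_tendsto_average_discount_arrival (hr : 0 < r) (hs : 0 < s)
    (hR : ∀ n, Resamples P (expMeasure r) (R n))
    (hXR : ∀ n ω y, X (R n ω y) = Function.update (X ω) n y)
    (hSR : ∀ n ω y, S (R n ω y) = S ω)
    (hXm : ∀ n, Measurable fun ω => X ω n)
    (hSm : ∀ n, Measurable fun ω => S ω n) (hS : ∀ᵐ ω ∂P, ∀ n, 0 ≤ S ω n) :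
    ∀ᵐ ω ∂P, Tendsto (fun n : ℕ => (∑ k ∈ Finset.range n,
      (Real.exp (-(s * S ω (k + 1))) * Real.exp (-(s * idle (X ω) (S ω) k))
        - Real.exp (-(s * S ω (k + 1)))
          * (1 - s / (r + s) * Real.exp (-(r * sojourn (X ω) (S ω) k))))) / n) atTop (𝓝 0) := by
  have := isProbabilityMeasure_expMeasure hr
  have hVm := measurable_sojourn hXm hSm
  have hIm := measurable_idle hXm hSm
  have hY : ∀ k, ∀ᵐ ω ∂P, 0 ≤ Real.exp (-(s * S ω (k + 1))) * Real.exp (-(s * idle (X ω) (S ω) k))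
      ∧ Real.exp (-(s * S ω (k + 1))) * Real.exp (-(s * idle (X ω) (S ω) k)) ≤ 1 := fun k => by
    filter_upwards [hS] with ω h
    refine ⟨by positivity, ?_⟩
    rw [← Real.exp_add, Real.exp_le_one_iff]
    linarith [mul_nonneg hs.le (h (k + 1)), mul_nonneg hs.le (idle_nonneg (X ω) (S ω) k)]
  have he : ∀ k, ∀ᵐ ω ∂P, 0 ≤ Real.exp (-(s * S ω (k + 1)))
          * (1 - s / (r + s) * Real.exp (-(r * sojourn (X ω) (S ω) k)))
      ∧ Real.exp (-(s * S ω (k + 1)))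
          * (1 - s / (r + s) * Real.exp (-(r * sojourn (X ω) (S ω) k))) ≤ 1 := fun k => by
    filter_upwards [hS] with ω h
    have h1 := one_sub_mem_Icc hr hs ((h k).trans (le_sojourn (X := X ω) k))
    refine ⟨mul_nonneg (Real.exp_pos _).le h1.1, mul_le_one₀ ?_ h1.1 h1.2⟩
    rw [Real.exp_le_one_iff]
    linarith [mul_nonneg hs.le (h (k + 1))]
  have hYm : ∀ k, Measurable fun ω =>
      Real.exp (-(s * S ω (k + 1))) * Real.exp (-(s * idle (X ω) (S ω) k)) := fun k => by
    have h1 := hSm (k + 1)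
    have h2 := hIm k
    fun_prop
  have hem : ∀ k, Measurable fun ω => Real.exp (-(s * S ω (k + 1)))
      * (1 - s / (r + s) * Real.exp (-(r * sojourn (X ω) (S ω) k))) := fun k => by
    have h1 := hSm (k + 1)
    have h2 := hVm k
    fun_prop
  refine ae_tendsto_average_compensated_of_le_one hYm hem hY he fun j k hjk => ?_
  refine (hR (k + 1)).integral_eq_zero ?_ ?_
  · refine Integrable.of_bound (((hYm j).sub (hem j)).mul
      ((hYm k).sub (hem k))).aestronglyMeasurable 1 ?_
    filter_upwards [hY j, hY k, he j, he k] with ω h1 h2 h3 h4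
    rw [norm_mul]
    exact mul_le_one₀ (norm_sub_le_one h1 h3) (norm_nonneg _) (norm_sub_le_one h2 h4)
  · filter_upwards [hS] with ω h
    have hV : 0 ≤ sojourn (X ω) (S ω) k := (h k).trans (le_sojourn k)
    have e : ∀ y, (Real.exp (-(s * S (R (k + 1) ω y) (j + 1)))
          * Real.exp (-(s * idle (X (R (k + 1) ω y)) (S (R (k + 1) ω y)) j))
        - Real.exp (-(s * S (R (k + 1) ω y) (j + 1))) * (1 - s / (r + s)
          * Real.exp (-(r * sojourn (X (R (k + 1) ω y)) (S (R (k + 1) ω y)) j))))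
        * (Real.exp (-(s * S (R (k + 1) ω y) (k + 1)))
          * Real.exp (-(s * idle (X (R (k + 1) ω y)) (S (R (k + 1) ω y)) k))
        - Real.exp (-(s * S (R (k + 1) ω y) (k + 1))) * (1 - s / (r + s)
          * Real.exp (-(r * sojourn (X (R (k + 1) ω y)) (S (R (k + 1) ω y)) k))))
        = ((Real.exp (-(s * S ω (j + 1))) * Real.exp (-(s * idle (X ω) (S ω) j))
        - Real.exp (-(s * S ω (j + 1)))
          * (1 - s / (r + s) * Real.exp (-(r * sojourn (X ω) (S ω) j))))
          * Real.exp (-(s * S ω (k + 1))))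
          * (Real.exp (-(s * max (y - sojourn (X ω) (S ω) k) 0))
            - (1 - s / (r + s) * Real.exp (-(r * sojourn (X ω) (S ω) k)))) := fun y => by
      simp only [hXR, hSR]
      rw [idle_update_arrival _ _ _ (by omega), sojourn_update_arrival _ _ _ (by omega),
        idle_update_arrival_self, sojourn_update_arrival _ _ _ (by omega)]
      ring
    refine (integral_congr_ae (ae_of_all _ e)).trans ?_
    rw [integral_const_mul, integral_exp_neg_max_sub_expMeasure hr hs hV, mul_zero]

/-- Averaging the next service time out of the discounted time between departures. -/
lemma ae_tendsto_average_discount_service {m : Measure ℝ} [IsProbabilityMeasure m]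
    (hm : ∀ᵐ x ∂m, 0 ≤ x) (hr : 0 < r) (hs : 0 < s)
    (hR : ∀ n, Resamples P m (R n))
    (hXR : ∀ n ω y, X (R n ω y) = X ω)
    (hSR : ∀ n ω y, S (R n ω y) = Function.update (S ω) n y)
    (hXm : ∀ n, Measurable fun ω => X ω n)
    (hSm : ∀ n, Measurable fun ω => S ω n) (hS : ∀ᵐ ω ∂P, ∀ n, 0 ≤ S ω n) :
    ∀ᵐ ω ∂P, Tendsto (fun n : ℕ => (∑ k ∈ Finset.range n,
      (Real.exp (-(s * S ω (k + 1)))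
          * (1 - s / (r + s) * Real.exp (-(r * sojourn (X ω) (S ω) k)))
        - (∫ x, Real.exp (-(s * x)) ∂m)
          * (1 - s / (r + s) * Real.exp (-(r * sojourn (X ω) (S ω) k))))) / n) atTop (𝓝 0) := by
  have hVm := measurable_sojourn hXm hSm
  have hmi : Integrable (fun x => Real.exp (-(s * x))) m := by
    refine Integrable.of_bound (by fun_prop) 1 ?_
    filter_upwards [hm] with x hx
    rw [Real.norm_of_nonneg (Real.exp_pos _).le, Real.exp_le_one_iff]
    linarith [mul_nonneg hs.le hx]
  set φ := ∫ x, Real.exp (-(s * x)) ∂m with hφ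
  have hφ0 : 0 ≤ φ := integral_nonneg fun x => (Real.exp_pos _).le
  have hφ1 : φ ≤ 1 := by
    have h1 : φ ≤ ∫ _, (1 : ℝ) ∂m := by
      refine integral_mono_ae hmi (integrable_const _) ?_
      filter_upwards [hm] with x hx
      rw [Real.exp_le_one_iff]
      linarith [mul_nonneg hs.le hx]
    simpa using h1
  set q : ℕ → Ω → ℝ := fun k ω => 1 - s / (r + s) * Real.exp (-(r * sojourn (X ω) (S ω) k))
    with hq
  have hq01 : ∀ k, ∀ᵐ ω ∂P, 0 ≤ q k ω ∧ q k ω ≤ 1 := fun k => by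
    filter_upwards [hS] with ω h
    exact one_sub_mem_Icc hr hs ((h k).trans (le_sojourn (X := X ω) k))
  have hY : ∀ k, ∀ᵐ ω ∂P, 0 ≤ Real.exp (-(s * S ω (k + 1))) * q k ω
      ∧ Real.exp (-(s * S ω (k + 1))) * q k ω ≤ 1 := fun k => by
    filter_upwards [hS, hq01 k] with ω h h1
    refine ⟨mul_nonneg (Real.exp_pos _).le h1.1, mul_le_one₀ ?_ h1.1 h1.2⟩
    rw [Real.exp_le_one_iff]
    linarith [mul_nonneg hs.le (h (k + 1))]
  have he : ∀ k, ∀ᵐ ω ∂P, 0 ≤ φ * q k ω ∧ φ * q k ω ≤ 1 := fun k => by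
    filter_upwards [hq01 k] with ω h1
    exact ⟨mul_nonneg hφ0 h1.1, mul_le_one₀ hφ1 h1.1 h1.2⟩
  have hqm : ∀ k, Measurable (q k) := fun k => by
    have h2 := hVm k
    fun_prop
  have hYm : ∀ k, Measurable fun ω => Real.exp (-(s * S ω (k + 1))) * q k ω := fun k => by
    have h1 := hSm (k + 1)
    have h2 := hqm k
    fun_prop
  have hem : ∀ k, Measurable fun ω => φ * q k ω := fun k => (hqm k).const_mul φ
  refine ae_tendsto_average_compensated_of_le_one hYm hem hY he fun j k hjk => ?_
  refine (hR (k + 1)).integral_eq_zero ?_ (ae_of_all _ fun ω => ?_)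
  · refine Integrable.of_bound (((hYm j).sub (hem j)).mul
      ((hYm k).sub (hem k))).aestronglyMeasurable 1 ?_
    filter_upwards [hY j, hY k, he j, he k] with ω h1 h2 h3 h4
    rw [norm_mul]
    exact mul_le_one₀ (norm_sub_le_one h1 h3) (norm_nonneg _) (norm_sub_le_one h2 h4)
  -- Sojourn times up to index `k` do not involve service `k + 1`, so resampling it changes a single
  -- factor.
  · have hqR : ∀ y, ∀ i ≤ k, q i (R (k + 1) ω y) = q i ω := fun y i hi => by
      simp only [hq, hXR, hSR]
      rw [sojourn_update_service _ _ _ (by omega)]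
    have e : ∀ y, (Real.exp (-(s * S (R (k + 1) ω y) (j + 1))) * q j (R (k + 1) ω y)
          - φ * q j (R (k + 1) ω y))
        * (Real.exp (-(s * S (R (k + 1) ω y) (k + 1))) * q k (R (k + 1) ω y)
          - φ * q k (R (k + 1) ω y))
        = ((Real.exp (-(s * S ω (j + 1))) * q j ω - φ * q j ω) * q k ω)
          * (Real.exp (-(s * y)) - φ) := fun y => by
      rw [hqR y j hjk.le, hqR y k le_rfl, hSR, Function.update_self,
        Function.update_of_ne (by omega)]
      ring
    refine (integral_congr_ae (ae_of_all _ e)).trans ?_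
    rw [integral_const_mul, integral_sub hmi (integrable_const _)]
    simp [hφ]

end FCFS

/-! ### Almost sure properties of the driving randomness -/

/-- The shift `c` accommodates averages that start at index 1, since gap 0 and service 0 precede the
first inter-departure time. -/
lemma ae_tendsto_average_infinitePi (m : Measure ℝ) [IsProbabilityMeasure m] {f : ℝ → ℝ}
    (hfm : Measurable f) (hf : Integrable f m) (c : ℕ) :
    ∀ᵐ x ∂(Measure.infinitePi fun _ : ℕ => m),
      Tendsto (fun n : ℕ => (∑ i ∈ Finset.range n, f (x (i + c))) / n) atTop (𝓝 (∫ x, f x ∂m)) := by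
  have hmp : ∀ i, MeasurePreserving (fun x : ℕ → ℝ => x i) (Measure.infinitePi fun _ : ℕ => m) m :=
    fun i => measurePreserving_eval_infinitePi (fun _ : ℕ => m) i
  have hind : iIndepFun (fun i (x : ℕ → ℝ) => f (x i)) (Measure.infinitePi fun _ : ℕ => m) :=
    iIndepFun_infinitePi (P := fun _ : ℕ => m) (X := fun _ => f) fun _ => hfm
  have hl : ∀ i, Measure.map (fun x : ℕ → ℝ => f (x i)) (Measure.infinitePi fun _ : ℕ => m)
      = Measure.map f m := fun i => by
    exact (Measure.map_map hfm (hmp i).measurable).symm.trans (by rw [(hmp i).map_eq])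
  have h := strong_law_ae_real (μ := Measure.infinitePi fun _ : ℕ => m)
    (fun i (x : ℕ → ℝ) => f (x (i + c)))
    (((hmp _).integrable_comp hf.aestronglyMeasurable).2 hf)
    (fun i j hij => hind.indepFun (by simpa using hij))
    (fun i => ⟨(hfm.comp (hmp _).measurable).aemeasurable,
      (hfm.comp (hmp _).measurable).aemeasurable, (hl _).trans (hl _).symm⟩)
  have e : ∫ x : ℕ → ℝ, f (x (0 + c)) ∂(Measure.infinitePi fun _ : ℕ => m) = ∫ x, f x ∂m := by
    rw [← integral_map (f := f) (hmp (0 + c)).aemeasurable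
      (by rw [(hmp (0 + c)).map_eq]; exact hf.aestronglyMeasurable), (hmp (0 + c)).map_eq]
  rw [e] at h
  exact h

lemma tendsto_epoch_atTop {g : ℕ → ℝ} {a : ℝ} (ha : 0 < a)
    (h : Tendsto (fun n : ℕ => (∑ i ∈ Finset.range n, g (i + 0)) / n) atTop (𝓝 a)) :
    Tendsto (epoch g) atTop atTop := by
  have h1 : Tendsto (fun n : ℕ => ∑ i ∈ Finset.range n, g i) atTop atTop := by
    refine (h.pos_mul_atTop ha tendsto_natCast_atTop_atTop).congr' ?_
    filter_upwards [eventually_gt_atTop 0] with n hn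
    have : (n : ℝ) ≠ 0 := by exact_mod_cast hn.ne'
    simp only [add_zero]
    field_simp
  exact h1.comp (tendsto_add_atTop_nat 1)

/-- Averages have the same limit if the averages of the differences vanish. -/
lemma tendsto_average_of_sub {a b : ℕ → ℝ} {l : ℝ}
    (h : Tendsto (fun n : ℕ => (∑ k ∈ Finset.range n, (a k - b k)) / n) atTop (𝓝 0))
    (hb : Tendsto (fun n : ℕ => (∑ k ∈ Finset.range n, b k) / n) atTop (𝓝 l)) :
    Tendsto (fun n : ℕ => (∑ k ∈ Finset.range n, a k) / n) atTop (𝓝 l) := by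
  have := h.add hb
  rw [zero_add] at this
  refine this.congr fun n => ?_
  rw [← add_div, ← Finset.sum_add_distrib]
  simp

lemma tendsto_average_const_mul_one_sub {a : ℕ → ℝ} {l : ℝ} (c d : ℝ)
    (ha : Tendsto (fun n : ℕ => (∑ k ∈ Finset.range n, a k) / n) atTop (𝓝 l)) :
    Tendsto (fun n : ℕ => (∑ k ∈ Finset.range n, c * (1 - d * a k)) / n) atTop
      (𝓝 (c * (1 - d * l))) := by
  refine (((ha.const_mul d).const_sub 1).const_mul c).congr' ?_
  filter_upwards [eventually_gt_atTop 0] with n hn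
  have : (n : ℝ) ≠ 0 := by exact_mod_cast hn.ne'
  rw [← Finset.mul_sum, Finset.sum_sub_distrib, ← Finset.mul_sum]
  simp only [Finset.sum_const, Finset.card_range, nsmul_eq_mul, mul_one]
  field_simp

lemma ae_tendsto_average_expMeasure {r : ℝ} (hr : 0 < r) (c : ℕ) :
    ∀ᵐ x ∂(Measure.infinitePi fun _ : ℕ => expMeasure r),
      Tendsto (fun n : ℕ => (∑ i ∈ Finset.range n, x (i + c)) / (n : ℝ)) atTop (𝓝 (1 / r)) := by
  have := isProbabilityMeasure_expMeasure hr
  have h1 := integral_pow_expMeasure hr 1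
  have h2 := integrable_pow_expMeasure hr 1
  simp only [pow_one, Nat.factorial_one, Nat.cast_one] at h1 h2
  have h := ae_tendsto_average_infinitePi (expMeasure r) measurable_id h2 c
  simpa only [id, h1] using h

namespace Params

variable (p : Params)

instance : IsProbabilityMeasure p.law := by
  unfold law
  infer_instance

/-- The Laplace transform of the service time at the decision rate. -/
noncomputable def laplace : ℝ := ∫ x, Real.exp (-(p.nu * x)) ∂p.service

/-- The missing probability of the bufferless system. -/
noncomputable def blockingMissing : ℝ := p.laplace * (p.lam / (p.lam + p.nu))

/-- The missing probability of the system with an infinite buffer. -/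
noncomputable def fcfsMissing : ℝ := p.laplace * (1 - p.nu / (p.lam + p.nu) * max (1 - p.rho) 0)

lemma measurePreserving_arrivals :
    MeasurePreserving (fun ω : (ℕ → ℝ) × (ℕ → ℝ) × (ℕ → ℝ) => ω.1) p.law
      (Measure.infinitePi fun _ : ℕ => expMeasure p.lam) :=
  measurePreserving_fst

lemma measurePreserving_services :
    MeasurePreserving (fun ω : (ℕ → ℝ) × (ℕ → ℝ) × (ℕ → ℝ) => ω.2.1) p.law
      (Measure.infinitePi fun _ : ℕ => p.service) :=
  measurePreserving_fst.comp measurePreserving_snd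

lemma measurePreserving_decisions :
    MeasurePreserving (fun ω : (ℕ → ℝ) × (ℕ → ℝ) × (ℕ → ℝ) => ω.2.2) p.law
      (Measure.infinitePi fun _ : ℕ => expMeasure p.nu) :=
  measurePreserving_snd.comp measurePreserving_snd

lemma resamples_arrivals (n : ℕ) :
    Resamples p.law (expMeasure p.lam) fun ω y => (Function.update ω.1 n y, ω.2) :=
  (resamples_infinitePi (expMeasure p.lam) n).fst _

lemma resamples_services (n : ℕ) :
    Resamples p.law p.service fun ω y => (ω.1, (Function.update ω.2.1 n y, ω.2.2)) :=
  ((resamples_infinitePi p.service n).fst _).snd _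

lemma resamples_decisions (n : ℕ) :
    Resamples p.law (expMeasure p.nu) fun ω y => (ω.1, (ω.2.1, Function.update ω.2.2 n y)) :=
  ((resamples_infinitePi (expMeasure p.nu) n).snd _).snd _

lemma ae_services_nonneg : ∀ᵐ ω ∂p.law, ∀ n, 0 ≤ ω.2.1 n :=
  ae_all_iff.2 fun n => ((measurePreserving_eval_infinitePi (fun _ : ℕ => p.service) n).comp
    p.measurePreserving_services).quasiMeasurePreserving.ae p.service_nonneg

lemma ae_decisions_nonneg : ∀ᵐ ω ∂p.law, ∀ n, 0 ≤ ω.2.2 n :=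
  ae_all_iff.2 fun n => ((measurePreserving_eval_infinitePi (fun _ : ℕ => expMeasure p.nu) n).comp
    p.measurePreserving_decisions).quasiMeasurePreserving.ae (ae_nonneg_expMeasure _)

lemma ae_arrivals_nonneg : ∀ᵐ ω ∂p.law, ∀ n, 0 ≤ ω.1 n :=
  ae_all_iff.2 fun n => ((measurePreserving_eval_infinitePi (fun _ : ℕ => expMeasure p.lam) n).comp
    p.measurePreserving_arrivals).quasiMeasurePreserving.ae (ae_nonneg_expMeasure _)

lemma ae_tendsto_average_arrivals (c : ℕ) : ∀ᵐ ω ∂p.law,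
    Tendsto (fun n : ℕ => (∑ i ∈ Finset.range n, ω.1 (i + c)) / (n : ℝ)) atTop (𝓝 (1 / p.lam)) :=
  p.measurePreserving_arrivals.quasiMeasurePreserving.ae (ae_tendsto_average_expMeasure p.lam_pos c)

lemma ae_tendsto_arrivals : ∀ᵐ ω ∂p.law, Tendsto (epoch ω.1) atTop atTop := by
  filter_upwards [p.ae_tendsto_average_arrivals 0] with ω h
  exact tendsto_epoch_atTop (one_div_pos.2 p.lam_pos) h

lemma ae_tendsto_decisions : ∀ᵐ ω ∂p.law, Tendsto (epoch ω.2.2) atTop atTop := by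
  filter_upwards [p.measurePreserving_decisions.quasiMeasurePreserving.ae
    (ae_tendsto_average_expMeasure p.nu_pos 0)] with ω h
  exact tendsto_epoch_atTop (one_div_pos.2 p.nu_pos) h

lemma ae_tendsto_average_services : ∀ᵐ ω ∂p.law,
    Tendsto (fun n : ℕ => (∑ i ∈ Finset.range n, ω.2.1 i) / (n : ℝ)) atTop (𝓝 (1 / p.mu)) := by
  have h := ae_tendsto_average_infinitePi p.service measurable_id p.integrable_service 0
  simp only [id, p.mean_service, add_zero] at h
  exact p.measurePreserving_services.quasiMeasurePreserving.ae h

lemma integrable_exp_neg_service :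
    Integrable (fun x => Real.exp (-(p.nu * x))) p.service := by
  refine Integrable.of_bound (by fun_prop) 1 ?_
  filter_upwards [p.service_nonneg] with x hx
  rw [Real.norm_of_nonneg (Real.exp_pos _).le, Real.exp_le_one_iff]
  linarith [mul_nonneg p.nu_pos.le hx]

lemma laplace_nonneg : 0 ≤ p.laplace := integral_nonneg fun _ => (Real.exp_pos _).le

lemma laplace_le_one : p.laplace ≤ 1 := by
  have h1 : p.laplace ≤ ∫ _, (1 : ℝ) ∂p.service := by
    refine integral_mono_ae p.integrable_exp_neg_service (integrable_const _) ?_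
    filter_upwards [p.service_nonneg] with x hx
    rw [Real.exp_le_one_iff]
    linarith [mul_nonneg p.nu_pos.le hx]
  simpa using h1

lemma ae_tendsto_average_exp_services : ∀ᵐ ω ∂p.law,
    Tendsto (fun n : ℕ => (∑ i ∈ Finset.range n, Real.exp (-(p.nu * ω.2.1 (i + 1)))) / n) atTop
      (𝓝 p.laplace) :=
  p.measurePreserving_services.quasiMeasurePreserving.ae
    (ae_tendsto_average_infinitePi p.service (f := fun x => Real.exp (-(p.nu * x))) (by fun_prop)
      p.integrable_exp_neg_service 1)

lemma rho_pos : 0 < p.rho := div_pos p.lam_pos p.mu_pos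

end Params

/-! ### The missing probabilities -/

lemma measurable_arrival (n : ℕ) :
    Measurable fun ω : (ℕ → ℝ) × (ℕ → ℝ) × (ℕ → ℝ) => ω.1 n := by fun_prop

lemma measurable_service (n : ℕ) :
    Measurable fun ω : (ℕ → ℝ) × (ℕ → ℝ) × (ℕ → ℝ) => ω.2.1 n := by fun_prop

lemma measurable_decision (n : ℕ) :
    Measurable fun ω : (ℕ → ℝ) × (ℕ → ℝ) × (ℕ → ℝ) => ω.2.2 n := by fun_prop

lemma measurable_arrivalEpoch (n : ℕ) :
    Measurable fun ω : (ℕ → ℝ) × (ℕ → ℝ) × (ℕ → ℝ) => epoch ω.1 n :=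
  (measurable_epoch n).comp measurable_fst

/-- The missing probability is the limit of the averages of the discounted times between
departures. -/
lemma isMissingProbability_of_average {dep : (ℕ → ℝ) → (ℕ → ℝ) → ℕ → ℝ} {p : Params} {q : ℝ}
    (hm : ∀ n, Measurable fun ω : (ℕ → ℝ) × (ℕ → ℝ) × (ℕ → ℝ) => dep (epoch ω.1) ω.2.1 n)
    (hmono : ∀ᵐ ω ∂p.law, Monotone (dep (epoch ω.1) ω.2.1))
    (h0 : ∀ᵐ ω ∂p.law, 0 ≤ dep (epoch ω.1) ω.2.1 0)
    (htop : ∀ᵐ ω ∂p.law, Tendsto (dep (epoch ω.1) ω.2.1) atTop atTop)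
    (hq : ∀ᵐ ω ∂p.law, Tendsto (fun n : ℕ => (∑ k ∈ Finset.range n, Real.exp (-(p.nu *
      (dep (epoch ω.1) ω.2.1 (k + 1) - dep (epoch ω.1) ω.2.1 k)))) / n) atTop (𝓝 q)) :
    IsMissingProbability dep p q := by
  have h := ae_tendsto_average_missed (P := p.law) (D := fun ω => dep (epoch ω.1) ω.2.1)
    (Z := fun ω => ω.2.2) (R := fun n ω y => (ω.1, (ω.2.1, Function.update ω.2.2 n y)))
    p.nu_pos p.resamples_decisions (fun _ _ _ => rfl) (fun _ _ _ => rfl)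
    measurable_decision hm p.ae_decisions_nonneg p.ae_tendsto_decisions hmono h0
  unfold IsMissingProbability
  filter_upwards [h, hmono, htop, hq] with ω h1 h2 h3 h4
  exact tendsto_missingRatio h2 h3 (tendsto_average_of_sub h1 h4)

/-- The exponential idle time contributes the factor λ/(λ+ν) and the service its Laplace transform
at ν. -/
theorem isMissingProbability_blocking (p : Params) :
    IsMissingProbability blockingDeparture p p.blockingMissing := by
  refine isMissingProbability_of_average
    (measurable_blockingDeparture measurable_arrivalEpoch measurable_service) ?_ ?_ ?_ ?_
  · filter_upwards [p.ae_tendsto_arrivals, p.ae_services_nonneg] with ω h1 h2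
    exact blockingDeparture_mono h1 h2
  · filter_upwards [p.ae_arrivals_nonneg, p.ae_services_nonneg] with ω h1 h2
    simpa [blockingDeparture, successful, epoch] using add_nonneg (h1 0) (h2 0)
  · filter_upwards [p.ae_tendsto_arrivals, p.ae_services_nonneg] with ω h1 h2
    exact tendsto_blockingDeparture h1 h2
  · filter_upwards [ae_tendsto_average_blocking (P := p.law) (X := fun ω => ω.1)
      (S := fun ω => ω.2.1)
      (R := fun n ω y => (Function.update ω.1 n y, ω.2))
      p.lam_pos p.nu_pos p.resamples_arrivals (fun _ _ _ => rfl) (fun _ _ _ => rfl)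
      measurable_arrival measurable_service p.ae_tendsto_arrivals p.ae_services_nonneg,
      p.ae_tendsto_average_exp_services] with ω h1 h2
    refine tendsto_average_of_sub h1 ((h2.mul_const (p.lam / (p.lam + p.nu))).congr fun n => ?_)
    rw [← Finset.sum_mul, div_mul_eq_mul_div]

theorem isMissingProbability_fcfs (p : Params) :
    IsMissingProbability fcfsDeparture p p.fcfsMissing := by
  refine isMissingProbability_of_average
    (measurable_fcfsDeparture measurable_arrivalEpoch measurable_service) ?_ ?_ ?_ ?_
  · filter_upwards [p.ae_services_nonneg] with ω h2
    exact fcfsDeparture_mono h2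
  · filter_upwards [p.ae_arrivals_nonneg, p.ae_services_nonneg] with ω h1 h2
    simpa [fcfsDeparture, epoch] using add_nonneg (h1 0) (h2 0)
  · filter_upwards [p.ae_tendsto_arrivals, p.ae_services_nonneg] with ω h1 h2
    exact tendsto_fcfsDeparture h2 h1
  · have hX : ∀ n, MeasurePreserving (fun ω : (ℕ → ℝ) × (ℕ → ℝ) × (ℕ → ℝ) => ω.1 n) p.law
        (expMeasure p.lam) := fun n =>
      (measurePreserving_eval_infinitePi (fun _ : ℕ => expMeasure p.lam) n).comp
        p.measurePreserving_arrivals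
    filter_upwards [ae_tendsto_average_idle (P := p.law) (X := fun ω => ω.1) (S := fun ω => ω.2.1)
        (R := fun n ω y => (Function.update ω.1 n y, ω.2))
        p.lam_pos p.resamples_arrivals (fun _ _ _ => rfl) (fun _ _ _ => rfl) hX
        measurable_service p.ae_services_nonneg,
      ae_tendsto_average_discount_arrival (P := p.law) (X := fun ω => ω.1) (S := fun ω => ω.2.1)
        (R := fun n ω y => (Function.update ω.1 n y, ω.2))
        p.lam_pos p.nu_pos p.resamples_arrivals (fun _ _ _ => rfl) (fun _ _ _ => rfl)
        measurable_arrival measurable_service p.ae_services_nonneg,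
      ae_tendsto_average_discount_service (P := p.law) (X := fun ω => ω.1) (S := fun ω => ω.2.1)
        (R := fun n ω y => (ω.1, (Function.update ω.2.1 n y, ω.2.2)))
        p.service_nonneg p.lam_pos p.nu_pos p.resamples_services (fun _ _ _ => rfl)
        (fun _ _ _ => rfl) measurable_arrival measurable_service p.ae_services_nonneg,
      p.ae_tendsto_average_arrivals 1, p.ae_tendsto_average_services] with ω h1 h2 h3 h4 h5
    have h6 := tendsto_average_idle h4 h5
    -- Equating the pathwise average of the idle times (`h6`) with the average of their conditional
    -- means (`h1`) yields the average of `exp (-λ V)` without any stationary distribution.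
    have h7 : Tendsto (fun n : ℕ => (∑ k ∈ Finset.range n,
        Real.exp (-(p.lam * sojourn ω.1 ω.2.1 k))) / n) atTop (𝓝 (max (1 - p.rho) 0)) := by
      have h8 := (h6.sub h1).const_mul p.lam
      have e : p.lam * (max (1 / p.lam - 1 / p.mu) 0 - 0) = max (1 - p.rho) 0 := by
        rw [sub_zero, mul_max_of_nonneg _ _ p.lam_pos.le, mul_sub, mul_zero,
          mul_one_div_cancel p.lam_pos.ne', mul_one_div, Params.rho]
      rw [e] at h8
      refine h8.congr fun n => ?_
      rw [← sub_div, ← Finset.sum_sub_distrib, ← mul_div_assoc, Finset.mul_sum]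
      congr 1
      refine Finset.sum_congr rfl fun k _ => ?_
      have := p.lam_pos.ne'
      field_simp
      ring
    have h9 := tendsto_average_of_sub h2 (tendsto_average_of_sub h3
      (tendsto_average_const_mul_one_sub p.laplace (p.nu / (p.lam + p.nu)) h7))
    refine h9.congr fun n => ?_
    congr 1
    refine Finset.sum_congr rfl fun k _ => ?_
    rw [fcfsDeparture_succ_eq, ← Real.exp_add]
    congr 1
    ring

/-- Sign and size are read off this form: the first two factors lie in [0, 1] and the last one
equals min(ρ, 1). -/
lemma fcfsMissing_sub_blockingMissing (p : Params) :
    p.fcfsMissing - p.blockingMissing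
      = p.laplace * (p.nu / (p.lam + p.nu) * (1 - max (1 - p.rho) 0)) := by
  have h := p.lam_pos
  have h' := p.nu_pos
  have e : p.lam / (p.lam + p.nu) = 1 - p.nu / (p.lam + p.nu) := by
    field_simp
    ring
  rw [Params.fcfsMissing, Params.blockingMissing, e]
  ring

lemma fcfsMissing_sub_blockingMissing_nonneg (p : Params) :
    0 ≤ p.fcfsMissing - p.blockingMissing := by
  rw [fcfsMissing_sub_blockingMissing]
  have h := p.lam_pos
  have h' := p.nu_pos
  have h1 : max (1 - p.rho) 0 ≤ 1 := max_le (by linarith [p.rho_pos]) zero_le_one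
  exact mul_nonneg p.laplace_nonneg (mul_nonneg (by positivity) (by linarith))

lemma fcfsMissing_sub_blockingMissing_le (p : Params) :
    p.fcfsMissing - p.blockingMissing ≤ p.rho := by
  rw [fcfsMissing_sub_blockingMissing]
  have h := p.lam_pos
  have h' := p.nu_pos
  have h1 : max (1 - p.rho) 0 ≤ 1 := max_le (by linarith [p.rho_pos]) zero_le_one
  have h2 : 1 - max (1 - p.rho) 0 ≤ p.rho := by linarith [le_max_left (1 - p.rho) 0]
  have h3 : p.nu / (p.lam + p.nu) ≤ 1 := (div_le_one (by positivity)).2 (by linarith)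
  have h4 : p.nu / (p.lam + p.nu) * (1 - max (1 - p.rho) 0) ≤ 1 - max (1 - p.rho) 0 :=
    mul_le_of_le_one_left (by linarith) h3
  have h5 : 0 ≤ p.nu / (p.lam + p.nu) * (1 - max (1 - p.rho) 0) :=
    mul_nonneg (by positivity) (by linarith)
  exact (mul_le_of_le_one_left h5 p.laplace_le_one).trans (h4.trans h2)

end UpdateDecision

theorem theorem3 :
    ∃ pBlocking pFCFS : UpdateDecision.Params → ℝ,
      (∀ p : UpdateDecision.Params,
        UpdateDecision.IsMissingProbability UpdateDecision.blockingDeparture p (pBlocking p) ∧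
        UpdateDecision.IsMissingProbability UpdateDecision.fcfsDeparture p (pFCFS p) ∧
        pBlocking p ≤ pFCFS p) ∧
      Tendsto (fun p : UpdateDecision.Params => pFCFS p - pBlocking p)
        (comap UpdateDecision.Params.rho (𝓝 0)) (𝓝 0) := by
  refine ⟨UpdateDecision.Params.blockingMissing, UpdateDecision.Params.fcfsMissing,
    fun p => ⟨UpdateDecision.isMissingProbability_blocking p,
      UpdateDecision.isMissingProbability_fcfs p,
      sub_nonneg.1 (UpdateDecision.fcfsMissing_sub_blockingMissing_nonneg p)⟩, ?_⟩
  -- The bound involves only ρ, so convergence holds along `comap rho (𝓝 0)`, which encodes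
  -- uniformity over λ, ν and the service law.
  exact squeeze_zero UpdateDecision.fcfsMissing_sub_blockingMissing_nonneg
    UpdateDecision.fcfsMissing_sub_blockingMissing_le tendsto_comap
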